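/- Let $\mathbb{H}=\{z\in\mathbb{C} : \operatorname{Im} z>0\}$ and $\Lambda=(0,1)\cup(\mathbb{C}\setminus\mathbb{R})$. Let $$F(z)=\frac1\pi\int_0^1\frac{dt}{\sqrt{t(1-t)(1-tz)}},\qquad z\in\mathbb{C}\setminus[1,+\infty)$$ (principal branch of the square root), which is the holomorphic extension to $\mathbb{C}\setminus[1,+\infty)$ of the Gauss hypergeometric function $F(\tfrac12,\tfrac12;1;z)$, and let $$i_e(z)= i\,\frac{F(1-z)}{F(z)},\qquad z\in\Lambda,$$ be the Schwarz triangle function. Let $$\mathcal{F}=\{z\in\mathbb{H} : -1<\operatorname{Re} z<1,\ |2z-1|>1,\ |2z+1|>1\}$$ be the fundamental quadrilateral. **Lemma.** Suppose $f$ is holomorphic on $\mathcal{F}$ and extends continuously to its hyperbolic closure $\mathbb{H}\cap\operatorname{clos}\mathcal{F}$ (the extension is again denoted by $f$). Suppose that the boundary values satisfy (a) $f(z)=f(z+2)$ and (b) $f(-1/z)=f\big(-1/(z+2)\big)$ for each $z\in -1+i\mathbb{R}_{>0}$. Suppose finally that there exist nonnegative integers $n_\infty$, $n_0$, $n_1$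 such that 1. $|f(z)|=o\big(\exp(\pi(n_\infty+1)|z|)\big)$ as $\mathcal{F}\ni z\to\infty$, 2. $|f(z)|=o\big(\exp(\pi(n_0+1)|z|^{-1})\big)$ as $\mathcal{F}\ni z\to 0$, 3. $|f(z)|=o\big(\exp(\pi(n_1+1)|z-\sigma|^{-1})\big)$ as $\mathcal{F}\ni z\to\sigma$, for both $\sigma=1$ and $\sigma=-1$. Then there exists a polynomial $P$ with complex coefficients, of degree at most $n_\infty+n_0+n_1$, such that $$f\big(i_e(z)\big)=\frac{P(z)}{z^{n_\infty}(1-z)^{n_0}},\qquad z\in\Lambda.$$ -/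

import Mathlib

namespace SchwarzTriangle

/-- The Gauss hypergeometric function `F(1/2, 1/2; 1; z)` on `ℂ ∖ [1, +∞)`, the holomorphic
extension of the series `∑ ((1/2)_n / n!)² zⁿ` from the unit disc, given by Euler's integral
`(1/π) ∫₀¹ dt / √(t (1 - t) (1 - t z))`. For `z ∉ [1, +∞)` and `0 ≤ t ≤ 1` the number `1 - t z`
lies off the cut `(-∞, 0]` of the principal branch of the square root. -/
noncomputable def hypF (z : ℂ) : ℂ :=
  (1 / (Real.pi : ℂ)) *
    ∫ t in (0 : ℝ)..1, 1 / ((Real.sqrt (t * (1 - t)) : ℂ) * (1 - (t : ℂ) * z) ^ (1 / 2 : ℂ))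

/-- The doubly slit plane `Λ = (0, 1) ∪ (ℂ ∖ ℝ)`. -/
def slitDomain : Set ℂ :=
  (fun x : ℝ => (x : ℂ)) '' Set.Ioo (0 : ℝ) 1 ∪ {z : ℂ | z.im ≠ 0}

/-- The Schwarz triangle function `z ↦ i F(1 - z) / F(z)`, considered on `slitDomain`. -/
noncomputable def schwarzTriangle (z : ℂ) : ℂ :=
  Complex.I * (hypF (1 - z) / hypF z)

/-- The open upper half-plane, as a subset of `ℂ`. -/
def upperHalfPlane : Set ℂ := {z : ℂ | 0 < z.im}

/-- The fundamental quadrilateral: the ideal hyperbolic quadrilateral in the upper half-plane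
with vertices `∞, -1, 0, 1`. -/
def fundamentalQuadrilateral : Set ℂ :=
  {z : ℂ | z ∈ upperHalfPlane ∧ -1 < z.re ∧ z.re < 1 ∧ 1 < ‖2 * z - 1‖ ∧ 1 < ‖2 * z + 1‖}

end SchwarzTriangle

open Complex Set Filter Topology MeasureTheory

namespace SchwarzTriangle

/-! Write `i_e` for `schwarzTriangle` and g = f ∘ i_e. Since `i_e` maps Λ into the quadrilateral, g
is holomorphic on Λ; bijectivity of `i_e` plays no role. The side pairings (a) and (b) make g extend
continuously across the slits (-∞, 0) and (1, ∞), hence holomorphically to ℂ ∖ {0, 1} by Morera. The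
growth conditions say that z^{n_∞} (1 - z)^{n_0} g(z) has removable singularities at 0 and 1 and is
o(|z|^{N+1}) at infinity, N = n_∞ + n_0 + n_1, so Cauchy's estimates make it a polynomial of degree
at most N.

What is needed about `i_e` comes from a second solution B (`hypB`) of the hypergeometric equation,
holomorphic off [0, ∞). Cauchy's theorem gives the connection formula F(1 - z) = B(z) - iF(z) for Im
z > 0 (`arcsineMean_connection`), so i_e = ±1 + iB/F in the upper and lower half-plane. As B/F is
continuous across the negative axis, the two boundary values there differ by 2, which is where (a)
enters. The signs of the real and imaginary parts of F, B and B/F place `i_e` in the quadrilateral.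

The symmetries i_e(1 - z) = -1/i_e(z) and (i_e(z) - 1)(i_e(1/z) + 1) = -1 for Im z > 0 carry the
points 1 and ∞ to 0. There π|i_e(z)| ≤ log(1/|z|) + C (`eventually_norm_schwarzTriangle_bounds`);
the coefficient 1 of the logarithm is what turns exp(π(n+1)|w|) into |z|^{-(n+1)} exactly. -/

/-! ### Morera, removable singularities and Liouville -/

theorem differentiableOn_of_continuousOn_of_im_ne_zero {g : ℂ → ℂ} {U : Set ℂ} (hU : IsOpen U)
    (hc : ContinuousOn g U) (hd : ∀ z ∈ U, z.im ≠ 0 → DifferentiableAt ℂ g z) :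
    DifferentiableOn ℂ g U := by
  intro c hcU
  obtain ⟨r, hr, hball⟩ := Metric.isOpen_iff.1 hU c hcU
  have hcb := hc.mono hball
  -- Cauchy's theorem on a rectangle needs differentiability only in the open interior, so an edge
  -- may lie on the real axis.
  have key : ∀ z w : ℂ, Complex.Rectangle z w ⊆ Metric.ball c r →
      (0 : ℝ) ∉ Ioo (min z.im w.im) (max z.im w.im) →
      (∫ x : ℝ in z.re..w.re, g (x + z.im * I)) - (∫ x : ℝ in z.re..w.re, g (x + w.im * I)) +
      I • (∫ y : ℝ in z.im..w.im, g (w.re + y * I)) -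
      I • (∫ y : ℝ in z.im..w.im, g (z.re + y * I)) = 0 := by
    intro z w hzw h0
    apply integral_boundary_rect_eq_zero_of_continuousOn_of_differentiableOn g z w (hcb.mono hzw)
    intro u hu
    apply DifferentiableAt.differentiableWithinAt
    rw [mem_reProdIm] at hu
    apply hd u
    · apply hball (hzw _)
      rw [Complex.Rectangle, mem_reProdIm, Set.uIcc, Set.uIcc]
      exact ⟨Ioo_subset_Icc_self hu.1, Ioo_subset_Icc_self hu.2⟩
    · intro h
      rw [h] at hu
      exact h0 hu.2
  have hcons : IsConservativeOn g (Metric.ball c r) := by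
    intro z w hzw
    rw [← add_eq_zero_iff_eq_neg, wedgeIntegral_add_wedgeIntegral_eq]
    -- A rectangle straddling the axis is cut along it; the two integrals over the cut cancel.
    by_cases h0 : (0 : ℝ) ∈ Ioo (min z.im w.im) (max z.im w.im)
    · have h0' : (0 : ℝ) ∈ uIcc z.im w.im := Ioo_subset_Icc_self h0
      have s1 : Complex.Rectangle z ⟨w.re, 0⟩ ⊆ Metric.ball c r := by
        refine Subset.trans ?_ hzw
        intro u hu
        rw [Complex.Rectangle, mem_reProdIm] at hu ⊢
        exact ⟨hu.1, uIcc_subset_uIcc left_mem_uIcc h0' hu.2⟩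
      have s2 : Complex.Rectangle ⟨z.re, 0⟩ w ⊆ Metric.ball c r := by
        refine Subset.trans ?_ hzw
        intro u hu
        rw [Complex.Rectangle, mem_reProdIm] at hu ⊢
        exact ⟨hu.1, uIcc_subset_uIcc h0' right_mem_uIcc hu.2⟩
      have e1 := key _ _ s1 (by simp only [mem_Ioo, min_lt_iff, lt_max_iff]; grind)
      have e2 := key _ _ s2 (by simp only [mem_Ioo, min_lt_iff, lt_max_iff]; grind)
      have hint : ∀ a ∈ uIcc z.re w.re, ∀ p ∈ uIcc z.im w.im, ∀ q ∈ uIcc z.im w.im,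
          IntervalIntegrable (fun y : ℝ => g (a + y * I)) MeasureTheory.volume p q := by
        intro a ha p hp q hq
        apply ContinuousOn.intervalIntegrable
        apply (hcb.mono hzw).comp (by fun_prop)
        intro y hy
        rw [Complex.Rectangle, mem_reProdIm]
        exact ⟨by simpa using ha, by simpa using uIcc_subset_uIcc hp hq hy⟩
      simp only at e1 e2
      rw [← intervalIntegral.integral_add_adjacent_intervals
          (hint _ right_mem_uIcc _ left_mem_uIcc _ h0')
          (hint _ right_mem_uIcc _ h0' _ right_mem_uIcc),
        ← intervalIntegral.integral_add_adjacent_intervals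
          (hint _ left_mem_uIcc _ left_mem_uIcc _ h0')
          (hint _ left_mem_uIcc _ h0' _ right_mem_uIcc)]
      linear_combination (exp := 1) e1 + e2
    · exact key z w hzw h0
  have := (hcons.isExactOn_ball hcb).differentiableOn Metric.isOpen_ball
  exact (this.differentiableAt (Metric.ball_mem_nhds c hr)).differentiableWithinAt

/-- Inequalities between continuous functions extend from the nonreal numbers to an open set. -/
theorem le_of_forall_im_ne_zero {p q : ℂ → ℝ} {U : Set ℂ} (hU : IsOpen U)
    (hp : ContinuousOn p U) (hq : ContinuousOn q U) (h : ∀ z ∈ U, z.im ≠ 0 → p z ≤ q z) :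
    ∀ z ∈ U, p z ≤ q z := by
  intro z hz
  by_cases him : z.im ≠ 0
  · exact h z hz him
  have hz0 : z.im = 0 := by simpa using him
  have ht : Tendsto (fun ε : ℝ => z + ε * I) (𝓝[>] 0) (𝓝 z) := by
    have : ContinuousAt (fun ε : ℝ => z + ε * I) 0 := by fun_prop
    have h2 := this.tendsto
    simp only [ofReal_zero, zero_mul, add_zero] at h2
    exact h2.mono_left nhdsWithin_le_nhds
  refine le_of_tendsto_of_tendsto (((hp z hz).continuousAt (hU.mem_nhds hz)).tendsto.comp ht)
    (((hq z hz).continuousAt (hU.mem_nhds hz)).tendsto.comp ht) ?_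
  filter_upwards [ht.eventually (hU.mem_nhds hz), self_mem_nhdsWithin] with ε h1 h2
  apply h _ h1
  simp [hz0, (show (0:ℝ) < ε from h2).ne']

/-- An entire function that is `o(|z| ^ (N + 1))` at infinity is a polynomial of degree at most
`N`. -/
theorem exists_polynomial_of_isLittleO {G : ℂ → ℂ} (hG : Differentiable ℂ G) (N : ℕ)
    (h : ∀ ε > 0, ∃ R : ℝ, ∀ z : ℂ, R < ‖z‖ → ‖G z‖ ≤ ε * ‖z‖ ^ (N + 1)) :
    ∃ P : Polynomial ℂ, P.natDegree ≤ N ∧ ∀ z, G z = P.eval z := by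
  have hz : ∀ k, N + 1 ≤ k → iteratedDeriv k G 0 = 0 := by
    intro k hk
    rw [← norm_le_zero_iff]
    apply le_of_forall_pos_le_add
    intro ε hε
    -- The factor 1/k! absorbs the k! of Cauchy's estimate, and S ≥ 1 gives S ^ (N + 1) ≤ S ^ k.
    obtain ⟨R, hR⟩ := h (ε / k.factorial) (by positivity)
    set S := max (R + 1) 1 with hS
    have hS1 : 1 ≤ S := le_max_right _ _
    have hb := norm_iteratedDeriv_le_of_forall_mem_sphere_norm_le (c := 0) (R := S)
      (C := ε / k.factorial * S ^ (N + 1)) k (by linarith) hG.diffContOnCl (by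
        intro z hz
        have hzn : ‖z‖ = S := by simpa using hz
        have := hR z (by rw [hzn]; linarith [le_max_left (R + 1) 1])
        rwa [hzn] at this)
    rw [zero_add]
    refine hb.trans ?_
    rw [div_le_iff₀ (by positivity)]
    have : (k.factorial : ℝ) * (ε / k.factorial * S ^ (N + 1)) = ε * S ^ (N + 1) := by
      field_simp
    rw [this]
    gcongr
  refine ⟨∑ k ∈ Finset.range (N + 1),
    Polynomial.monomial k ((k.factorial : ℂ)⁻¹ * iteratedDeriv k G 0), ?_, ?_⟩
  · apply Polynomial.natDegree_sum_le_of_forall_le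
    intro k hk
    exact (Polynomial.natDegree_monomial_le _).trans (by simpa [Nat.lt_succ_iff] using hk)
  · intro z
    rw [← taylorSeries_eq_of_entire hG 0 z, tsum_eq_sum (s := Finset.range (N + 1))]
    · rw [Polynomial.eval_finsetSum]
      apply Finset.sum_congr rfl
      intro k _
      simp
      ring
    · intro k hk
      rw [hz k (by simpa using hk)]
      simp

/-- Riemann's theorem with growth o(1/|z - c|). The value G c subtracted in the little-o criterion
is harmless because z - c tends to 0. -/
theorem exists_differentiableOn_eqOn_of_tendsto_sub_mul {G : ℂ → ℂ} {s : Set ℂ} {c : ℂ}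
    (hs : s ∈ 𝓝 c) (hG : DifferentiableOn ℂ G (s \ {c}))
    (h : Tendsto (fun z => (z - c) * G z) (𝓝[≠] c) (𝓝 0)) :
    ∃ G' : ℂ → ℂ, DifferentiableOn ℂ G' s ∧ EqOn G' G {c}ᶜ := by
  have hlim : Tendsto (fun z : ℂ => z - c) (𝓝[≠] c) (𝓝 0) := by
    have : ContinuousAt (fun z : ℂ => z - c) c := by fun_prop
    simpa using this.tendsto.mono_left nhdsWithin_le_nhds
  refine ⟨Function.update G c (limUnder (𝓝[≠] c) G),
    differentiableOn_update_limUnder_of_isLittleO hs hG ?_, fun z hz => ?_⟩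
  · rw [Asymptotics.isLittleO_iff_tendsto']
    · have := h.sub (hlim.mul_const (G c))
      simp only [zero_mul, sub_zero] at this
      refine this.congr fun z => ?_
      rw [div_inv_eq_mul]
      ring
    · filter_upwards [self_mem_nhdsWithin] with z hz h0
      exact absurd (sub_eq_zero.1 (inv_eq_zero.1 h0)) hz
  · exact Function.update_of_ne hz _ _

/-- A holomorphic function on `ℂ ∖ {0, 1}` with removable singularities at `0` and `1` and
growth `o(|z| ^ (N + 1))` at infinity is a polynomial of degree at most `N`. -/
theorem exists_polynomial_of_differentiableOn_compl {G : ℂ → ℂ}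
    (hG : DifferentiableOn ℂ G {0, 1}ᶜ)
    (h0 : Tendsto (fun z => z * G z) (𝓝[≠] 0) (𝓝 0))
    (h1 : Tendsto (fun z => (z - 1) * G z) (𝓝[≠] 1) (𝓝 0)) (N : ℕ)
    (h : ∀ ε > 0, ∃ R : ℝ, ∀ z : ℂ, R < ‖z‖ → ‖G z‖ ≤ ε * ‖z‖ ^ (N + 1)) :
    ∃ P : Polynomial ℂ, P.natDegree ≤ N ∧ ∀ z, z ≠ 0 → z ≠ 1 → G z = P.eval z := by
  obtain ⟨G₁, hG₁, e₁⟩ := exists_differentiableOn_eqOn_of_tendsto_sub_mul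
    (s := {1}ᶜ) (c := 0) (G := G) (isOpen_compl_singleton.mem_nhds (by simp))
    (hG.mono (by intro z hz; simp_all)) (by simpa using h0)
  have h1' : Tendsto (fun z => (z - 1) * G₁ z) (𝓝[≠] 1) (𝓝 0) := by
    refine h1.congr' ?_
    have : ({0}ᶜ : Set ℂ) ∈ 𝓝[≠] 1 :=
      nhdsWithin_le_nhds (isOpen_compl_singleton.mem_nhds (by simp))
    filter_upwards [this] with z hz
    rw [e₁ hz]
  obtain ⟨G₂, hG₂, e₂⟩ := exists_differentiableOn_eqOn_of_tendsto_sub_mul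
    (s := univ) (c := 1) (G := G₁) univ_mem (hG₁.mono (by intro z hz; simp_all)) h1'
  have e : ∀ z, z ≠ 0 → z ≠ 1 → G₂ z = G z := fun z hz0 hz1 => (e₂ hz1).trans (e₁ hz0)
  obtain ⟨P, hP, hP'⟩ := exists_polynomial_of_isLittleO (differentiableOn_univ.1 hG₂) N (by
    intro ε hε
    obtain ⟨R, hR⟩ := h ε hε
    refine ⟨max R 1, fun z hz => ?_⟩
    have hz1 : 1 < ‖z‖ := (le_max_right _ _).trans_lt hz
    rw [e z (by rintro rfl; simp at hz1; linarith) (by rintro rfl; simp at hz1)]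
    exact hR z ((le_max_left _ _).trans_lt hz))
  exact ⟨P, hP, fun z hz0 hz1 => by rw [← e z hz0 hz1, hP']⟩

/-! ### The principal inverse square root -/

/-- The principal branch of `z ↦ 1 / √z`. -/
noncomputable def invSqrt (z : ℂ) : ℂ := z ^ (-(1 / 2) : ℂ)

theorem invSqrt_sq (z : ℂ) : invSqrt z ^ 2 = z⁻¹ := by
  rw [invSqrt, ← Complex.cpow_nat_mul]
  norm_num [Complex.cpow_neg_one]

theorem invSqrt_re_pos {z : ℂ} (hz : z ∈ slitPlane) : 0 < (invSqrt z).re := by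
  rw [invSqrt, cpow_def_of_ne_zero (slitPlane_ne_zero hz), exp_re]
  have him : (log z * (-(1 / 2) : ℂ)).im = -(arg z / 2) := by
    have : (-(1 / 2) : ℂ) = ((-(1 / 2) : ℝ) : ℂ) := by push_cast; ring
    rw [this, im_mul_ofReal, log_im]
    ring
  rw [him]
  have h1 := neg_pi_lt_arg z
  have h2 : arg z < Real.pi := lt_of_le_of_ne (arg_le_pi z) (mem_slitPlane_iff_arg.1 hz).1
  apply mul_pos (Real.exp_pos _)
  apply Real.cos_pos_of_mem_Ioo
  constructor <;> linarith

theorem eq_of_sq_eq_of_re_pos {u v : ℂ} (hu : 0 < u.re) (hv : 0 < v.re) (h : u ^ 2 = v ^ 2) :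
    u = v := by
  rcases sq_eq_sq_iff_eq_or_eq_neg.1 h with h | h
  · exact h
  · rw [h, neg_re] at hu
    linarith

/-- A square root with positive real part is unique. The identities for `invSqrt` below thus reduce
to a squared identity and a sign, with no bookkeeping of arguments. -/
theorem eq_invSqrt {u z : ℂ} (hz : z ∈ slitPlane) (hu : 0 < u.re) (h : u ^ 2 = z⁻¹) :
    u = invSqrt z :=
  eq_of_sq_eq_of_re_pos hu (invSqrt_re_pos hz) (by rw [h, invSqrt_sq])

theorem mem_slitPlane_of_im_ne_zero {z : ℂ} (hz : z.im ≠ 0) : z ∈ slitPlane := Or.inr hz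

theorem two_mul_invSqrt_re_mul_im (z : ℂ) :
    2 * (invSqrt z).re * (invSqrt z).im = -z.im / normSq z := by
  have := congrArg im (invSqrt_sq z)
  rw [inv_im, sq, mul_im] at this
  linarith

theorem invSqrt_im_pos {z : ℂ} (hz : z.im < 0) : 0 < (invSqrt z).im := by
  have hs := mem_slitPlane_of_im_ne_zero hz.ne
  have h := two_mul_invSqrt_re_mul_im z
  have h1 := invSqrt_re_pos hs
  have h2 : 0 < -z.im / normSq z :=
    div_pos (by linarith) (normSq_pos.2 (slitPlane_ne_zero hs))
  rw [← h] at h2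
  exact pos_of_mul_pos_right h2 (by linarith)

theorem invSqrt_conj {z : ℂ} (hz : z ∈ slitPlane) :
    invSqrt (starRingEnd ℂ z) = starRingEnd ℂ (invSqrt z) := by
  have hc : starRingEnd ℂ z ∈ slitPlane := by
    rw [mem_slitPlane_iff] at hz ⊢
    simpa using hz
  refine (eq_invSqrt hc ?_ ?_).symm
  · simpa using invSqrt_re_pos hz
  · rw [← map_pow, invSqrt_sq, map_inv₀]

theorem invSqrt_im_neg {z : ℂ} (hz : 0 < z.im) : (invSqrt z).im < 0 := by
  have h := invSqrt_im_pos (z := starRingEnd ℂ z) (by simpa using hz)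
  rw [invSqrt_conj (mem_slitPlane_of_im_ne_zero hz.ne')] at h
  simpa using h

theorem norm_invSqrt (z : ℂ) : ‖invSqrt z‖ = 1 / √‖z‖ := by
  have h := congrArg norm (invSqrt_sq z)
  rw [norm_pow, norm_inv] at h
  rw [← Real.sqrt_sq (norm_nonneg (invSqrt z)), h, Real.sqrt_inv, one_div]

/-- For |arg z| ≤ π/2 the root has argument at most π/4 in modulus; here this appears as a
nonnegative real part of its square. -/
theorem norm_le_sqrt_two_mul_invSqrt_re {z : ℂ} (hz : 0 ≤ z.re) (hs : z ∈ slitPlane) :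
    ‖invSqrt z‖ ≤ √2 * (invSqrt z).re := by
  have h := congrArg re (invSqrt_sq z)
  rw [inv_re, sq, mul_re] at h
  have h1 : 0 ≤ z.re / normSq z := div_nonneg hz (normSq_nonneg _)
  have h2 := invSqrt_re_pos hs
  rw [Complex.norm_eq_sqrt_sq_add_sq]
  apply Real.sqrt_le_iff.2
  refine ⟨by positivity, ?_⟩
  rw [mul_pow, Real.sq_sqrt (by norm_num)]
  nlinarith

theorem invSqrt_one : invSqrt 1 = 1 := by
  simp [invSqrt]

theorem invSqrt_ofReal_mul {x : ℝ} (hx : 0 < x) {z : ℂ} (hz : z ∈ slitPlane) :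
    invSqrt (x * z) = ((1 / √x : ℝ) : ℂ) * invSqrt z := by
  have hs : (x : ℂ) * z ∈ slitPlane := by
    rw [mem_slitPlane_iff] at hz ⊢
    rw [re_ofReal_mul, im_ofReal_mul]
    rcases hz with h | h
    · exact Or.inl (by positivity)
    · exact Or.inr (mul_ne_zero hx.ne' h)
  refine (eq_invSqrt hs ?_ ?_).symm
  · rw [re_ofReal_mul]
    exact mul_pos (by positivity) (invSqrt_re_pos hz)
  · rw [mul_pow, invSqrt_sq, ← ofReal_pow, div_pow, Real.sq_sqrt hx.le]
    simp [mul_comm]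

/-- `1 / √(a b) = 1 / √a · 1 / √b` when `a` and `b` lie on different sides of the real axis. -/
theorem invSqrt_mul {a b : ℂ} (ha : a.im < 0) (hb : 0 < b.im) (hab : a * b ∈ slitPlane) :
    invSqrt (a * b) = invSqrt a * invSqrt b := by
  have hs := mem_slitPlane_of_im_ne_zero ha.ne
  have hs' := mem_slitPlane_of_im_ne_zero hb.ne'
  refine (eq_invSqrt hab ?_ ?_).symm
  -- The two roots have imaginary parts of opposite sign, so both terms of the real part of their
  -- product are positive.
  · rw [mul_re]
    have := mul_pos (invSqrt_re_pos hs) (invSqrt_re_pos hs')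
    have := mul_pos_of_neg_of_neg (neg_neg_of_pos (invSqrt_im_pos ha)) (invSqrt_im_neg hb)
    linarith
  · rw [mul_pow, invSqrt_sq, invSqrt_sq, mul_inv]

theorem hasDerivAt_invSqrt {z : ℂ} (hz : z ∈ slitPlane) :
    HasDerivAt invSqrt (-(1 / 2) * z ^ (-(1 / 2) - 1 : ℂ)) z := by
  have := (hasDerivAt_id z).cpow_const (c := (-(1 / 2) : ℂ)) hz
  rw [mul_one] at this
  exact this

theorem continuousOn_invSqrt : ContinuousOn invSqrt slitPlane :=
  fun _ hz => (hasDerivAt_invSqrt hz).continuousAt.continuousWithinAt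

/-! ### Means with respect to the arcsine law -/

/-- The density `1 / √(t (1 - t))` of the arcsine law on `(0, 1)`, up to the factor `1 / π`. -/
noncomputable def arcsineWeight (t : ℝ) : ℝ := 1 / √(t * (1 - t))

theorem arcsineWeight_pos {t : ℝ} (ht : t ∈ Ioo (0 : ℝ) 1) : 0 < arcsineWeight t := by
  have := mul_pos ht.1 (sub_pos.2 ht.2)
  unfold arcsineWeight
  positivity

theorem arcsineWeight_nonneg (t : ℝ) : 0 ≤ arcsineWeight t := by
  unfold arcsineWeight
  positivity

theorem hasDerivAt_arcsin_two_mul_sub_one {t : ℝ} (ht : t ∈ Ioo (0 : ℝ) 1) :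
    HasDerivAt (fun t : ℝ => Real.arcsin (2 * t - 1)) (arcsineWeight t) t := by
  have h := (Real.hasDerivAt_arcsin (x := 2 * t - 1) (by linarith [ht.1]) (by linarith [ht.2])).comp
    t (((hasDerivAt_id t).const_mul 2).sub_const 1)
  have h0 : 0 < t * (1 - t) := mul_pos ht.1 (sub_pos.2 ht.2)
  have h1 : 1 / √(1 - (2 * t - 1) ^ 2) * (2 * 1) = arcsineWeight t := by
    have : 1 - (2 * t - 1) ^ 2 = 2 ^ 2 * (t * (1 - t)) := by ring
    unfold arcsineWeight
    rw [this, Real.sqrt_mul (by norm_num), Real.sqrt_sq (by norm_num)]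
    have := Real.sqrt_pos.2 h0
    field_simp
  rw [h1] at h
  exact h

theorem integrableOn_arcsineWeight : IntegrableOn arcsineWeight (Ioc 0 1) := by
  apply intervalIntegral.integrableOn_deriv_of_nonneg (g := fun t : ℝ => Real.arcsin (2 * t - 1))
  · exact (Real.continuous_arcsin.comp (by fun_prop)).continuousOn
  · exact fun t ht => hasDerivAt_arcsin_two_mul_sub_one ht
  · exact fun t _ => arcsineWeight_nonneg t

theorem intervalIntegrable_arcsineWeight : IntervalIntegrable arcsineWeight volume 0 1 := by
  rw [intervalIntegrable_iff_integrableOn_Ioc_of_le zero_le_one]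
  exact integrableOn_arcsineWeight

theorem integral_arcsineWeight : ∫ t in (0 : ℝ)..1, arcsineWeight t = Real.pi := by
  rw [intervalIntegral.integral_eq_sub_of_hasDerivAt_of_le zero_le_one
    (Real.continuous_arcsin.comp (by fun_prop : Continuous fun t : ℝ => 2 * t - 1)).continuousOn
    (fun t ht => hasDerivAt_arcsin_two_mul_sub_one ht) intervalIntegrable_arcsineWeight]
  simp only [mul_one, Function.comp]
  norm_num

theorem arcsineWeight_one_sub (t : ℝ) : arcsineWeight (1 - t) = arcsineWeight t := by
  unfold arcsineWeight
  rw [sub_sub_cancel, mul_comm]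

/-- The mean of `1 / √m` with respect to the arcsine law on `(0, 1)`. -/
noncomputable def arcsineMean (m : ℝ → ℂ) : ℂ :=
  (1 / (Real.pi : ℂ)) * ∫ t in (0 : ℝ)..1, (arcsineWeight t : ℂ) * invSqrt (m t)

theorem hypF_eq_arcsineMean (z : ℂ) :
    SchwarzTriangle.hypF z = arcsineMean fun t => 1 - t * z := by
  unfold SchwarzTriangle.hypF arcsineMean arcsineWeight invSqrt
  congr 1
  apply intervalIntegral.integral_congr
  intro t _
  simp only [cpow_neg, one_div, mul_inv, ofReal_inv]

theorem intervalIntegrable_arcsineWeight_mul {k : ℝ → ℂ} (hk : ContinuousOn k (Icc 0 1)) :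
    IntervalIntegrable (fun t => (arcsineWeight t : ℂ) * k t) volume 0 1 := by
  have h : IntervalIntegrable (fun t => (arcsineWeight t : ℂ)) volume 0 1 :=
    intervalIntegrable_iff.2 (intervalIntegrable_iff.1 intervalIntegrable_arcsineWeight).ofReal
  exact h.mul_continuousOn (by rwa [uIcc_of_le zero_le_one])

theorem continuousOn_invSqrt_comp {m : ℝ → ℂ} (hm : Continuous m)
    (hs : ∀ t ∈ Icc (0 : ℝ) 1, m t ∈ slitPlane) :
    ContinuousOn (fun t => invSqrt (m t)) (Icc 0 1) :=
  continuousOn_invSqrt.comp hm.continuousOn hs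

theorem arcsineMean_reflect (m : ℝ → ℂ) : arcsineMean (fun t => m (1 - t)) = arcsineMean m := by
  unfold arcsineMean
  congr 1
  have := intervalIntegral.integral_comp_sub_left (a := 0) (b := 1)
    (fun t => (arcsineWeight t : ℂ) * invSqrt (m t)) 1
  simp only [sub_self, sub_zero, arcsineWeight_one_sub] at this
  exact this

theorem arcsineMean_congr {m n : ℝ → ℂ} (h : ∀ t ∈ Icc (0 : ℝ) 1, m t = n t) :
    arcsineMean m = arcsineMean n := by
  unfold arcsineMean
  congr 1
  apply intervalIntegral.integral_congr
  intro t ht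
  rw [uIcc_of_le zero_le_one] at ht
  simp only [h t ht]

/-- The open interval matters: in `hypB_div_hypF_im_pos` the quotients become real at t = 1, where
the sign conditions for factoring the root fail. -/
theorem arcsineMean_mul {m n : ℝ → ℂ} {c : ℂ}
    (h : ∀ t ∈ Ioo (0 : ℝ) 1, invSqrt (m t) = c * invSqrt (n t)) :
    arcsineMean m = c * arcsineMean n := by
  unfold arcsineMean
  rw [mul_left_comm, ← intervalIntegral.integral_const_mul c]
  congr 1
  rw [intervalIntegral.integral_of_le zero_le_one, intervalIntegral.integral_of_le zero_le_one,
    integral_Ioc_eq_integral_Ioo, integral_Ioc_eq_integral_Ioo]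
  apply setIntegral_congr_fun measurableSet_Ioo
  intro t ht
  simp only [h t ht]
  ring

theorem arcsineMean_conj {m : ℝ → ℂ} (hs : ∀ t ∈ Icc (0 : ℝ) 1, m t ∈ slitPlane) :
    arcsineMean (fun t => starRingEnd ℂ (m t)) = starRingEnd ℂ (arcsineMean m) := by
  unfold arcsineMean
  rw [map_mul, intervalIntegral.integral_of_le zero_le_one,
    intervalIntegral.integral_of_le zero_le_one, ← integral_conj]
  simp only [map_div₀, map_one, conj_ofReal]
  congr 1
  apply setIntegral_congr_fun measurableSet_Ioc
  intro t ht
  simp only [map_mul, conj_ofReal, invSqrt_conj (hs t (Ioc_subset_Icc_self ht))]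

theorem arcsineMean_one : arcsineMean (fun _ => 1) = 1 := by
  unfold arcsineMean
  simp only [invSqrt_one, mul_one]
  rw [intervalIntegral.integral_ofReal, integral_arcsineWeight]
  have : (Real.pi : ℂ) ≠ 0 := by exact_mod_cast Real.pi_ne_zero
  field_simp

theorem arcsineMean_re (m : ℝ → ℂ) (hm : Continuous m)
    (hs : ∀ t ∈ Icc (0 : ℝ) 1, m t ∈ slitPlane) :
    (arcsineMean m).re =
      1 / Real.pi * ∫ t in (0 : ℝ)..1, arcsineWeight t * (invSqrt (m t)).re := by
  have h := intervalIntegrable_arcsineWeight_mul (continuousOn_invSqrt_comp hm hs)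
  unfold arcsineMean
  rw [← ofReal_one, ← ofReal_div, re_ofReal_mul]
  congr 1
  have := reCLM.intervalIntegral_comp_comm h
  simpa using this.symm

theorem arcsineMean_im (m : ℝ → ℂ) (hm : Continuous m)
    (hs : ∀ t ∈ Icc (0 : ℝ) 1, m t ∈ slitPlane) :
    (arcsineMean m).im =
      1 / Real.pi * ∫ t in (0 : ℝ)..1, arcsineWeight t * (invSqrt (m t)).im := by
  have h := intervalIntegrable_arcsineWeight_mul (continuousOn_invSqrt_comp hm hs)
  unfold arcsineMean
  rw [← ofReal_one, ← ofReal_div, im_ofReal_mul]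
  congr 1
  have := imCLM.intervalIntegral_comp_comm h
  simpa using this.symm

theorem integral_arcsineWeight_mul_pos {k : ℝ → ℝ} (hk : ContinuousOn k (Icc 0 1))
    (hpos : ∀ t ∈ Ioo (0 : ℝ) 1, 0 < k t) : 0 < ∫ t in (0 : ℝ)..1, arcsineWeight t * k t := by
  apply intervalIntegral.intervalIntegral_pos_of_pos_on
  · exact intervalIntegrable_arcsineWeight.mul_continuousOn (by rwa [uIcc_of_le zero_le_one])
  · exact fun t ht => mul_pos (arcsineWeight_pos ht) (hpos t ht)
  · exact zero_lt_one

theorem arcsineMean_re_pos {m : ℝ → ℂ} (hm : Continuous m)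
    (hs : ∀ t ∈ Icc (0 : ℝ) 1, m t ∈ slitPlane) : 0 < (arcsineMean m).re := by
  rw [arcsineMean_re m hm hs]
  apply mul_pos (by positivity)
  apply integral_arcsineWeight_mul_pos
  · exact continuous_re.comp_continuousOn (continuousOn_invSqrt_comp hm hs)
  · exact fun t ht => invSqrt_re_pos (hs t (Ioo_subset_Icc_self ht))

theorem arcsineMean_im_pos {m : ℝ → ℂ} (hm : Continuous m)
    (hs : ∀ t ∈ Icc (0 : ℝ) 1, m t ∈ slitPlane) (hneg : ∀ t ∈ Ioo (0 : ℝ) 1, (m t).im < 0) :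
    0 < (arcsineMean m).im := by
  rw [arcsineMean_im m hm hs]
  apply mul_pos (by positivity)
  apply integral_arcsineWeight_mul_pos
  · exact continuous_im.comp_continuousOn (continuousOn_invSqrt_comp hm hs)
  · exact fun t ht => invSqrt_im_pos (hneg t ht)

theorem mem_slitPlane_conj {z : ℂ} (hz : z ∈ slitPlane) : starRingEnd ℂ z ∈ slitPlane := by
  rw [mem_slitPlane_iff] at hz ⊢
  simpa using hz

theorem arcsineMean_im_neg {m : ℝ → ℂ} (hm : Continuous m)
    (hs : ∀ t ∈ Icc (0 : ℝ) 1, m t ∈ slitPlane) (hpos : ∀ t ∈ Ioo (0 : ℝ) 1, 0 < (m t).im) :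
    (arcsineMean m).im < 0 := by
  have := arcsineMean_im_pos (m := fun t => starRingEnd ℂ (m t)) (continuous_conj.comp hm)
    (fun t ht => mem_slitPlane_conj (hs t ht)) (fun t ht => by simpa using hpos t ht)
  rw [arcsineMean_conj hs] at this
  simpa using this

/-- Differentiation under the integral. The slit plane condition holds up to t = 0 and t = 1, so the
derivative of the root is bounded on the compact [0, 1] × closed ball, and the weight times that
bound dominates. -/
theorem differentiableOn_arcsineMean {p q : ℝ → ℂ} (hp : Continuous p) (hq : Continuous q)
    {U : Set ℂ} (hU : IsOpen U)
    (hs : ∀ z ∈ U, ∀ t ∈ Icc (0 : ℝ) 1, p t + q t * z ∈ slitPlane) :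
    DifferentiableOn ℂ (fun z => arcsineMean fun t => p t + q t * z) U := by
  intro z₀ hz₀
  obtain ⟨r, hr, hball⟩ := Metric.nhds_basis_closedBall.mem_iff.1 (hU.mem_nhds hz₀)
  set k' : ℝ × ℂ → ℂ := fun x => -(1 / 2) * (p x.1 + q x.1 * x.2) ^ (-(1 / 2) - 1 : ℂ) * q x.1
  have hk' : ContinuousOn k' (Icc 0 1 ×ˢ Metric.closedBall z₀ r) := by
    apply ContinuousOn.mul _ (by fun_prop)
    apply ContinuousOn.mul continuousOn_const
    apply ContinuousOn.cpow_const (by fun_prop)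
    rintro ⟨t, z⟩ ⟨ht, hz⟩
    exact hs z (hball hz) t ht
  obtain ⟨C, hC⟩ := (isCompact_Icc.prod (isCompact_closedBall z₀ r)).exists_bound_of_continuousOn hk'
  have hcont : ∀ z ∈ U, ContinuousOn (fun t => invSqrt (p t + q t * z)) (Icc 0 1) := fun z hz =>
    continuousOn_invSqrt_comp (by fun_prop) (hs z hz)
  have hioc : ∀ t ∈ uIoc (0 : ℝ) 1, t ∈ Icc (0 : ℝ) 1 := fun t ht => by
    rw [uIoc_of_le zero_le_one] at ht
    exact Ioc_subset_Icc_self ht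
  have hder := (intervalIntegral.hasDerivAt_integral_of_dominated_loc_of_deriv_le
    (μ := volume) (a := 0) (b := 1) (x₀ := z₀) (s := Metric.ball z₀ r)
    (F := fun z t => (arcsineWeight t : ℂ) * invSqrt (p t + q t * z))
    (F' := fun z t => (arcsineWeight t : ℂ) * k' (t, z))
    (bound := fun t => arcsineWeight t * C) (Metric.ball_mem_nhds z₀ hr) ?_ ?_ ?_ ?_ ?_ ?_).2
  · exact (hder.differentiableAt.const_mul (1 / (Real.pi : ℂ))).differentiableWithinAt
  · filter_upwards [hU.mem_nhds hz₀] with z hz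
    exact (intervalIntegrable_iff.1
      (intervalIntegrable_arcsineWeight_mul (hcont z hz))).aestronglyMeasurable
  · exact intervalIntegrable_arcsineWeight_mul (hcont z₀ hz₀)
  · refine (intervalIntegrable_iff.1 (intervalIntegrable_arcsineWeight_mul
      (hk'.comp (f := fun t : ℝ => (t, z₀)) (by fun_prop) ?_))).aestronglyMeasurable
    exact fun t ht => ⟨ht, Metric.mem_closedBall_self hr.le⟩
  · refine Eventually.of_forall fun t ht z hz => ?_
    rw [norm_mul, norm_real, Real.norm_of_nonneg (arcsineWeight_nonneg t)]
    gcongr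
    · exact arcsineWeight_nonneg t
    · exact hC (t, z) ⟨hioc t ht, Metric.ball_subset_closedBall hz⟩
  · exact intervalIntegrable_arcsineWeight.mul_const C
  · refine Eventually.of_forall fun t ht z hz => ?_
    have h1 := hasDerivAt_invSqrt (hs z (hball (Metric.ball_subset_closedBall hz)) t (hioc t ht))
    have h2 : HasDerivAt (fun z => p t + q t * z) (q t) z := by
      simpa using ((hasDerivAt_id z).const_mul (q t)).const_add (p t)
    exact (h1.comp z h2).const_mul _

/-! ### The connection formula via Cauchy's theorem -/

/-- The integrand whose integral along the real axis vanishes by Cauchy's theorem in the lower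
half-plane; its integrals over `(-∞, -1)`, `(-1, 0)` and `(0, ∞)` are arcsine means. -/
noncomputable def lineIntegrand (z s : ℂ) : ℂ :=
  invSqrt (I * s) * invSqrt (I * (1 + s)) * invSqrt (1 + z * s)

/-- If 1 + zs were real and at most 0, then s would be a negative multiple of 1/z, which has
negative imaginary part, forcing Im s > 0. -/
theorem one_add_mul_mem_slitPlane {z s : ℂ} (hz : 0 < z.im) (hs : s.im ≤ 0) :
    1 + z * s ∈ slitPlane := by
  rw [mem_slitPlane_iff]
  by_contra! h
  simp only [add_re, one_re, mul_re, add_im, one_im, mul_im, zero_add] at h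
  obtain ⟨h1, h2⟩ := h
  have h3 : z.im * (z.re * s.re - z.im * s.im) = -(z.re ^ 2 + z.im ^ 2) * s.im := by
    linear_combination z.re * h2
  have h4 : 0 ≤ -(z.re ^ 2 + z.im ^ 2) * s.im := by nlinarith [sq_nonneg z.re, sq_nonneg z.im]
  nlinarith

/-- The factor `I` in `lineIntegrand` turns the cuts issuing from 0 and -1 into the upper
half-plane, leaving the lower one free. -/
theorem I_mul_mem_slitPlane {s : ℂ} (hs : s.im < 0) : I * s ∈ slitPlane := by
  rw [mem_slitPlane_iff]
  left
  simpa using hs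

theorem norm_lineIntegrand (z s : ℂ) :
    ‖lineIntegrand z s‖ = 1 / √‖s‖ * (1 / √‖1 + s‖) * (1 / √‖1 + z * s‖) := by
  unfold lineIntegrand
  simp only [norm_mul, norm_invSqrt, norm_I, one_mul]

theorem continuousAt_lineIntegrand {z s : ℂ} (hz : 0 < z.im) (hs : s.im ≤ 0)
    (h0 : I * s ∈ slitPlane) (h1 : I * (1 + s) ∈ slitPlane) :
    ContinuousAt (lineIntegrand z) s := by
  unfold lineIntegrand
  refine ContinuousAt.mul (ContinuousAt.mul ?_ ?_) ?_
  · exact ContinuousAt.comp (f := fun s : ℂ => I * s) (hasDerivAt_invSqrt h0).continuousAt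
      (by fun_prop)
  · exact ContinuousAt.comp (f := fun s : ℂ => I * (1 + s)) (hasDerivAt_invSqrt h1).continuousAt
      (by fun_prop)
  · exact ContinuousAt.comp (f := fun s : ℂ => 1 + z * s)
      (hasDerivAt_invSqrt (one_add_mul_mem_slitPlane hz hs)).continuousAt (by fun_prop)

theorem differentiableAt_lineIntegrand {z s : ℂ} (hz : 0 < z.im) (hs : s.im < 0) :
    DifferentiableAt ℂ (lineIntegrand z) s := by
  unfold lineIntegrand
  refine DifferentiableAt.mul (DifferentiableAt.mul ?_ ?_) ?_
  · exact DifferentiableAt.comp (f := fun s : ℂ => I * s) s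
      (hasDerivAt_invSqrt (I_mul_mem_slitPlane hs)).differentiableAt (by fun_prop)
  · exact DifferentiableAt.comp (f := fun s : ℂ => I * (1 + s)) s
      (hasDerivAt_invSqrt (I_mul_mem_slitPlane (s := 1 + s) (by simpa using hs))).differentiableAt
      (by fun_prop)
  · exact DifferentiableAt.comp (f := fun s : ℂ => 1 + z * s) s
      (hasDerivAt_invSqrt (one_add_mul_mem_slitPlane hz hs.le)).differentiableAt (by fun_prop)

/-- Three inverse square roots give decay of order R^(-3/2), which beats the length of a contour of
size R. -/
theorem norm_lineIntegrand_le {z s : ℂ} (hz : 0 < z.im) {R : ℝ} (hR : 2 ≤ R)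
    (hR' : 2 ≤ ‖z‖ * R) (hs : R ≤ ‖s‖) : ‖lineIntegrand z s‖ ≤ 2 / (√‖z‖ * (R * √R)) := by
  have hz0 : 0 < ‖z‖ := norm_pos_iff.2 (by rintro rfl; simp at hz)
  have hR0 : 0 < R := by linarith
  have h1 : R / 2 ≤ ‖1 + s‖ := by
    have := norm_sub_norm_le s (-1)
    rw [sub_neg_eq_add, norm_neg, norm_one, add_comm s] at this
    linarith
  have h2 : ‖z‖ * R / 2 ≤ ‖1 + z * s‖ := by
    have := norm_sub_norm_le (z * s) (-1)
    rw [sub_neg_eq_add, norm_neg, norm_one, add_comm (z * s), norm_mul] at this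
    nlinarith
  rw [norm_lineIntegrand]
  calc 1 / √‖s‖ * (1 / √‖1 + s‖) * (1 / √‖1 + z * s‖)
      ≤ 1 / √R * (1 / √(R / 2)) * (1 / √(‖z‖ * R / 2)) := by gcongr
    _ = 2 / (√‖z‖ * (R * √R)) := by
      rw [Real.sqrt_div hR0.le, Real.sqrt_div (by positivity), Real.sqrt_mul hz0.le]
      have a1 : √2 * √2 = 2 := Real.mul_self_sqrt (by norm_num)
      have a2 : √R * √R = R := Real.mul_self_sqrt hR0.le
      have a3 : 0 < √R := Real.sqrt_pos.2 hR0
      have a4 : 0 < √‖z‖ := Real.sqrt_pos.2 hz0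
      field_simp
      rw [pow_two, a1, pow_two, a2, mul_comm]

/-- The segment is closed by a rectangle in the lower half-plane; its other three sides have total
length 4R, and each is at distance at least R from 0. -/
theorem norm_intervalIntegral_lineIntegrand_le {z : ℂ} (hz : 0 < z.im) {ε R : ℝ} (hε : 0 < ε)
    (hR : 2 ≤ R) (hR' : 2 ≤ ‖z‖ * R) :
    ‖∫ x in (-R)..R, lineIntegrand z (x + (-ε : ℝ) * I)‖ ≤ 8 / (√‖z‖ * √R) := by
  have hz0 : 0 < ‖z‖ := norm_pos_iff.2 (by rintro rfl; simp at hz)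
  have hR0 : 0 < R := by linarith
  have a3 : 0 < √R := Real.sqrt_pos.2 hR0
  have a4 : 0 < √‖z‖ := Real.sqrt_pos.2 hz0
  set M := 2 / (√‖z‖ * (R * √R)) with hM
  have hrect := integral_boundary_rect_eq_zero_of_differentiableOn (lineIntegrand z)
    ⟨-R, -ε - R⟩ ⟨R, -ε⟩ (fun s hs => by
      rw [mem_reProdIm] at hs
      apply (differentiableAt_lineIntegrand hz _).differentiableWithinAt
      have := hs.2
      simp only [uIcc_of_le (show -ε - R ≤ -ε by linarith), mem_Icc] at this
      linarith)
  simp only at hrect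
  have b1 : ‖∫ x in (-R)..R, lineIntegrand z (x + (-ε - R : ℝ) * I)‖ ≤ M * |R - -R| := by
    apply intervalIntegral.norm_integral_le_of_norm_le_const
    intro x _
    apply norm_lineIntegrand_le hz hR hR'
    refine le_trans ?_ (abs_im_le_norm _)
    simp only [add_im, ofReal_im, mul_im, ofReal_re, I_im, I_re, mul_one, mul_zero, add_zero,
      zero_add]
    rw [abs_of_neg (by linarith)]
    linarith
  have b2 : ‖∫ y in (-ε - R)..(-ε), lineIntegrand z ((R : ℝ) + y * I)‖ ≤ M * |-ε - (-ε - R)| := by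
    apply intervalIntegral.norm_integral_le_of_norm_le_const
    intro y _
    apply norm_lineIntegrand_le hz hR hR'
    refine le_trans ?_ (abs_re_le_norm _)
    simp [le_abs_self]
  have b3 : ‖∫ y in (-ε - R)..(-ε), lineIntegrand z ((-R : ℝ) + y * I)‖ ≤
      M * |-ε - (-ε - R)| := by
    apply intervalIntegral.norm_integral_le_of_norm_le_const
    intro y _
    apply norm_lineIntegrand_le hz hR hR'
    refine le_trans ?_ (abs_re_le_norm _)
    simp [le_abs_self]
  rw [show R - -R = 2 * R by ring, abs_of_pos (by linarith)] at b1
  rw [show -ε - (-ε - R) = R by ring, abs_of_pos hR0] at b2 b3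
  have e : ∫ x in (-R)..R, lineIntegrand z (x + (-ε : ℝ) * I) =
      (∫ x in (-R)..R, lineIntegrand z (x + (-ε - R : ℝ) * I)) +
      I • (∫ y in (-ε - R)..(-ε), lineIntegrand z ((R : ℝ) + y * I)) -
      I • (∫ y in (-ε - R)..(-ε), lineIntegrand z ((-R : ℝ) + y * I)) := by
    linear_combination (exp := 1) -hrect
  rw [e]
  have hfin : M * (2 * R) + M * R + M * R = 8 / (√‖z‖ * √R) := by
    rw [hM]; field_simp; ring
  rw [← hfin]
  refine (norm_sub_le _ _).trans (add_le_add ((norm_add_le _ _).trans (add_le_add b1 ?_)) ?_)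
  · rwa [norm_smul, norm_I, one_mul]
  · rwa [norm_smul, norm_I, one_mul]

/-- The branch points 0, -1 and -1/z all have nonnegative imaginary part, so moving down from the
real axis increases the distance to each. This supplies a dominating function uniform in ε. -/
theorem norm_lineIntegrand_sub_le {z : ℂ} (hz : 0 < z.im) {ε x : ℝ} (hε : 0 < ε)
    (hx : x ≠ 0) (hx' : x ≠ -1) :
    ‖lineIntegrand z (x + (-ε : ℝ) * I)‖ ≤ ‖lineIntegrand z x‖ := by
  have hz0 : z ≠ 0 := by rintro rfl; simp at hz
  have h0 : 0 < ‖(x : ℂ)‖ := norm_pos_iff.2 (by exact_mod_cast hx)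
  have h1 : 0 < ‖1 + (x : ℂ)‖ := norm_pos_iff.2 (by
    norm_cast; intro h; exact hx' (by linarith))
  have h2 : 0 < ‖1 + z * x‖ :=
    norm_pos_iff.2 (slitPlane_ne_zero (one_add_mul_mem_slitPlane hz (by simp)))
  have i0 : ‖(x : ℂ)‖ ≤ ‖(x : ℂ) + (-ε : ℝ) * I‖ := by
    simp only [Complex.norm_eq_sqrt_sq_add_sq]
    apply Real.sqrt_le_sqrt
    simp
    positivity
  have i1 : ‖1 + (x : ℂ)‖ ≤ ‖1 + ((x : ℂ) + (-ε : ℝ) * I)‖ := by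
    simp only [Complex.norm_eq_sqrt_sq_add_sq]
    apply Real.sqrt_le_sqrt
    simp
    positivity
  have i2 : ‖1 + z * x‖ ≤ ‖1 + z * ((x : ℂ) + (-ε : ℝ) * I)‖ := by
    simp only [Complex.norm_eq_sqrt_sq_add_sq]
    apply Real.sqrt_le_sqrt
    simp
    nlinarith [mul_pos hz hε, mul_nonneg (sq_nonneg ε) (sq_nonneg z.re),
      mul_nonneg (sq_nonneg ε) (sq_nonneg z.im)]
  rw [norm_lineIntegrand, norm_lineIntegrand]
  gcongr

theorem integrableOn_image_and_setIntegral_image {h : ℝ → ℂ} {φ φ' : ℝ → ℝ} {m : ℝ → ℂ} {c : ℂ}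
    (hm : Continuous m) (hs : ∀ t ∈ Icc (0 : ℝ) 1, m t ∈ slitPlane)
    (hφ : ∀ t ∈ Ioo (0 : ℝ) 1, HasDerivAt φ (φ' t) t) (hinj : InjOn φ (Ioo 0 1))
    (heq : ∀ t ∈ Ioo (0 : ℝ) 1,
      |φ' t| • h (φ t) = c * ((arcsineWeight t : ℂ) * invSqrt (m t))) :
    IntegrableOn h (φ '' Ioo 0 1) ∧
      ∫ x in φ '' Ioo 0 1, h x = c * (Real.pi * arcsineMean m) := by
  have hint := intervalIntegrable_arcsineWeight_mul (continuousOn_invSqrt_comp hm hs)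
  rw [intervalIntegrable_iff_integrableOn_Ioo_of_le zero_le_one] at hint
  have hd : ∀ t ∈ Ioo (0 : ℝ) 1, HasDerivWithinAt φ (φ' t) (Ioo 0 1) t :=
    fun t ht => (hφ t ht).hasDerivWithinAt
  constructor
  · rw [integrableOn_image_iff_integrableOn_abs_deriv_smul measurableSet_Ioo hd hinj]
    exact (integrableOn_congr_fun heq measurableSet_Ioo).2 (hint.const_mul c)
  · rw [integral_image_eq_integral_abs_deriv_smul measurableSet_Ioo hd hinj,
      setIntegral_congr_fun measurableSet_Ioo heq, integral_const_mul]
    congr 1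
    unfold arcsineMean
    rw [intervalIntegral.integral_of_le zero_le_one, integral_Ioc_eq_integral_Ioo, ← mul_assoc]
    have : (Real.pi : ℂ) ≠ 0 := by exact_mod_cast Real.pi_ne_zero
    rw [mul_one_div_cancel this, one_mul]

theorem one_sub_mul_mem_slitPlane {z : ℂ} (hz : 1 - z ∈ slitPlane) {t : ℝ}
    (ht : t ∈ Icc (0 : ℝ) 1) : 1 - t * z ∈ slitPlane := by
  have h := starConvex_one_slitPlane hz (sub_nonneg.2 ht.2) ht.1 (sub_add_cancel _ _)
  convert h using 1
  simp only [real_smul]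
  push_cast
  ring

theorem sub_mem_slitPlane {z : ℂ} (hz : -z ∈ slitPlane) {t : ℝ} (ht : 0 ≤ t) :
    (t : ℂ) - z ∈ slitPlane := by
  rw [mem_slitPlane_iff] at hz ⊢
  simp only [neg_re, neg_im, sub_re, ofReal_re, sub_im, ofReal_im, zero_sub] at hz ⊢
  rcases hz with h | h
  · left; linarith
  · right; exact h

theorem neg_I_mem_slitPlane : -I ∈ slitPlane := by simp [mem_slitPlane_iff]

theorem I_mem_slitPlane : I ∈ slitPlane := by simp [mem_slitPlane_iff]

theorem invSqrt_neg_I_mul_invSqrt_I : invSqrt (-I) * invSqrt I = 1 := by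
  rw [← invSqrt_mul (by simp) (by simp) (by simp), neg_mul, I_mul_I, neg_neg, invSqrt_one]

/-- One of the substitutions s = -t, t/(1 - t), -1/t that parametrise the three real intervals by
(0, 1). The phases come from the two rotated roots: `invSqrt (-I) * invSqrt I` = 1 here, then
`invSqrt I` ^ 2 = -i and `invSqrt (-I)` ^ 2 = i for the other two. -/
theorem lineIntegrand_neg (z : ℂ) {t : ℝ} (ht : t ∈ Ioo (0 : ℝ) 1) :
    lineIntegrand z (-t : ℝ) = arcsineWeight t * invSqrt (1 - t * z) := by
  have e1 : I * ((-t : ℝ) : ℂ) = (t : ℂ) * -I := by push_cast; ring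
  have e2 : I * (1 + ((-t : ℝ) : ℂ)) = ((1 - t : ℝ) : ℂ) * I := by push_cast; ring
  have e3 : 1 + z * ((-t : ℝ) : ℂ) = 1 - t * z := by push_cast; ring
  have h1 : 0 < 1 - t := sub_pos.2 ht.2
  unfold lineIntegrand arcsineWeight
  rw [e1, e2, e3, invSqrt_ofReal_mul ht.1 neg_I_mem_slitPlane, invSqrt_ofReal_mul h1
    I_mem_slitPlane, Real.sqrt_mul ht.1.le]
  push_cast
  linear_combination (1 / (√t : ℂ) * (1 / (√(1 - t) : ℂ)) * invSqrt (1 - t * z)) *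
    invSqrt_neg_I_mul_invSqrt_I

theorem lineIntegrand_div_one_sub {z : ℂ} (hz : 0 < z.im) {t : ℝ} (ht : t ∈ Ioo (0 : ℝ) 1) :
    |1 / (1 - t) ^ 2| • lineIntegrand z (t / (1 - t) : ℝ) =
      -I * (arcsineWeight t * invSqrt (1 - t * (1 - z))) := by
  have h1 : 0 < 1 - t := sub_pos.2 ht.2
  have h1c : (1 - t : ℂ) ≠ 0 := by exact_mod_cast h1.ne'
  have hs : 1 - (t : ℂ) * (1 - z) ∈ slitPlane :=
    one_sub_mul_mem_slitPlane (by simpa using mem_slitPlane_of_im_ne_zero hz.ne')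
      (Ioo_subset_Icc_self ht)
  have e1 : I * ((t / (1 - t) : ℝ) : ℂ) = ((t / (1 - t) : ℝ) : ℂ) * I := mul_comm _ _
  have e2 : I * (1 + ((t / (1 - t) : ℝ) : ℂ)) = ((1 / (1 - t) : ℝ) : ℂ) * I := by
    push_cast; field_simp; ring
  have e3 : 1 + z * ((t / (1 - t) : ℝ) : ℂ) = ((1 / (1 - t) : ℝ) : ℂ) * (1 - t * (1 - z)) := by
    push_cast; field_simp; ring
  have hI : invSqrt I * invSqrt I = -I := by rw [← sq, invSqrt_sq, inv_I]
  unfold lineIntegrand arcsineWeight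
  rw [e1, e2, e3, invSqrt_ofReal_mul (div_pos ht.1 h1) I_mem_slitPlane,
    invSqrt_ofReal_mul (one_div_pos.2 h1) I_mem_slitPlane,
    invSqrt_ofReal_mul (one_div_pos.2 h1) hs, Real.sqrt_mul ht.1.le, real_smul,
    abs_of_pos (by positivity), Real.sqrt_div ht.1.le, Real.sqrt_div zero_le_one, Real.sqrt_one]
  have key : 1 / (1 - t) ^ 2 * (1 / (√t / √(1 - t))) * (1 / (1 / √(1 - t))) *
      (1 / (1 / √(1 - t))) = 1 / (√t * √(1 - t)) := by
    have a1 : √(1 - t) * √(1 - t) = 1 - t := Real.mul_self_sqrt h1.le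
    have a2 : 0 < √(1 - t) := Real.sqrt_pos.2 h1
    have a3 : 0 < √t := Real.sqrt_pos.2 ht.1
    rw [show (1 - t) ^ 2 = (√(1 - t) * √(1 - t)) ^ 2 by rw [a1]]
    field_simp
  rw [← key]
  push_cast
  rw [← hI]
  ring

theorem lineIntegrand_neg_inv {z : ℂ} (hz : 0 < z.im) {t : ℝ} (ht : t ∈ Ioo (0 : ℝ) 1) :
    |1 / t ^ 2| • lineIntegrand z (-t⁻¹ : ℝ) =
      I * (arcsineWeight t * invSqrt (t - z)) := by
  have h1 : 0 < 1 - t := sub_pos.2 ht.2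
  have h0 := ht.1
  have h0c : (t : ℂ) ≠ 0 := by exact_mod_cast h0.ne'
  have hs : (t : ℂ) - z ∈ slitPlane := mem_slitPlane_of_im_ne_zero (by simpa using hz.ne')
  have e1 : I * ((-t⁻¹ : ℝ) : ℂ) = ((1 / t : ℝ) : ℂ) * -I := by push_cast; ring
  have e2 : I * (1 + ((-t⁻¹ : ℝ) : ℂ)) = (((1 - t) / t : ℝ) : ℂ) * -I := by
    push_cast; field_simp; ring
  have e3 : 1 + z * ((-t⁻¹ : ℝ) : ℂ) = ((1 / t : ℝ) : ℂ) * (t - z) := by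
    push_cast; field_simp; ring
  have hI : invSqrt (-I) * invSqrt (-I) = I := by rw [← sq, invSqrt_sq, inv_neg, inv_I, neg_neg]
  unfold lineIntegrand arcsineWeight
  rw [e1, e2, e3, invSqrt_ofReal_mul (one_div_pos.2 h0) neg_I_mem_slitPlane,
    invSqrt_ofReal_mul (div_pos h1 h0) neg_I_mem_slitPlane,
    invSqrt_ofReal_mul (one_div_pos.2 h0) hs, Real.sqrt_mul ht.1.le, real_smul,
    abs_of_pos (by positivity), Real.sqrt_div h1.le, Real.sqrt_div zero_le_one, Real.sqrt_one]
  have key : 1 / t ^ 2 * (1 / (1 / √t)) * (1 / (√(1 - t) / √t)) *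
      (1 / (1 / √t)) = 1 / (√t * √(1 - t)) := by
    have a1 : √t * √t = t := Real.mul_self_sqrt h0.le
    have a2 : 0 < √(1 - t) := Real.sqrt_pos.2 h1
    have a3 : 0 < √t := Real.sqrt_pos.2 ht.1
    rw [show t ^ 2 = (√t * √t) ^ 2 by rw [a1]]
    field_simp
  rw [← key]
  push_cast
  generalize invSqrt (-I) = a at hI ⊢
  rw [← hI]
  ring

theorem image_neg_Ioo_zero_one : (fun t : ℝ => -t) '' Ioo 0 1 = Ioo (-1) 0 := by
  simp

theorem image_div_one_sub_Ioo : (fun t : ℝ => t / (1 - t)) '' Ioo 0 1 = Ioi 0 := by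
  ext x
  simp only [mem_image, mem_Ioo, mem_Ioi]
  constructor
  · rintro ⟨t, ⟨h0, h1⟩, rfl⟩
    exact div_pos h0 (by linarith)
  · intro hx
    refine ⟨x / (1 + x), ⟨by positivity, ?_⟩, ?_⟩
    · rw [div_lt_one (by linarith)]; linarith
    · have : 1 + x ≠ 0 := by positivity
      have h2 : 1 - x / (1 + x) = 1 / (1 + x) := by field_simp; ring
      rw [h2]
      field_simp

theorem image_neg_inv_Ioo : (fun t : ℝ => -t⁻¹) '' Ioo 0 1 = Iio (-1) := by
  ext x
  simp only [mem_image, mem_Ioo, mem_Iio]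
  constructor
  · rintro ⟨t, ⟨h0, h1⟩, rfl⟩
    have := (one_lt_inv₀ h0).2 h1
    linarith
  · intro hx
    refine ⟨(-x)⁻¹, ⟨inv_pos.2 (by linarith), ?_⟩, by simp⟩
    exact inv_lt_one_of_one_lt₀ (by linarith)

theorem integrable_lineIntegrand_and_integral {z : ℂ} (hz : 0 < z.im) :
    Integrable (fun x : ℝ => lineIntegrand z x) ∧
      ∫ x : ℝ, lineIntegrand z x = I * (Real.pi * arcsineMean fun t => t - z) +
        Real.pi * (arcsineMean fun t => 1 - t * z) +
        -I * (Real.pi * arcsineMean fun t => 1 - t * (1 - z)) := by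
  have hsz : z ∈ slitPlane := mem_slitPlane_of_im_ne_zero hz.ne'
  obtain ⟨i1, v1⟩ := integrableOn_image_and_setIntegral_image
    (h := fun x : ℝ => lineIntegrand z x) (φ := fun t => -t) (φ' := fun _ => -1)
    (m := fun t => 1 - t * z) (c := 1) (by fun_prop)
    (fun t ht => one_sub_mul_mem_slitPlane
      (mem_slitPlane_of_im_ne_zero (by simpa using hz.ne')) ht)
    (fun t _ => hasDerivAt_neg t) neg_injective.injOn
    (fun t ht => by rw [lineIntegrand_neg z ht]; simp)
  obtain ⟨i2, v2⟩ := integrableOn_image_and_setIntegral_image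
    (h := fun x : ℝ => lineIntegrand z x) (φ := fun t => t / (1 - t))
    (φ' := fun t => 1 / (1 - t) ^ 2)
    (m := fun t => 1 - t * (1 - z)) (c := -I) (by fun_prop)
    (fun t ht => one_sub_mul_mem_slitPlane (by simpa using hsz) ht)
    (fun t ht => by
      have h1 : (1 - t) ≠ 0 := (sub_pos.2 ht.2).ne'
      have := (hasDerivAt_id t).div ((hasDerivAt_id t).const_sub 1) h1
      convert! this using 1
      simp)
    (fun t ht s hs h => by
      have h1 : (1 - t) ≠ 0 := (sub_pos.2 ht.2).ne'
      have h2 : (1 - s) ≠ 0 := (sub_pos.2 hs.2).ne'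
      have := (div_eq_div_iff h1 h2).1 h
      linarith)
    (fun t ht => lineIntegrand_div_one_sub hz ht)
  obtain ⟨i3, v3⟩ := integrableOn_image_and_setIntegral_image
    (h := fun x : ℝ => lineIntegrand z x) (φ := fun t => -t⁻¹)
    (φ' := fun t => 1 / t ^ 2)
    (m := fun t => t - z) (c := I) (by fun_prop)
    (fun t ht => mem_slitPlane_of_im_ne_zero (by simpa using hz.ne'))
    (fun t ht => by
      have := (hasDerivAt_inv ht.1.ne').neg
      convert! this using 1
      simp)
    (fun t ht s hs h => by simpa using h)
    (fun t ht => lineIntegrand_neg_inv hz ht)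
  rw [image_neg_Ioo_zero_one] at i1 v1
  rw [image_div_one_sub_Ioo] at i2 v2
  rw [image_neg_inv_Ioo] at i3 v3
  have hae : ∀ᵐ x : ℝ, x ∈ (Iio (-1) ∪ Ioo (-1) 0) ∪ Ioi (0 : ℝ) := by
    have h0 : ∀ᵐ x : ℝ, x ≠ 0 := Measure.ae_ne volume 0
    have h1 : ∀ᵐ x : ℝ, x ≠ -1 := Measure.ae_ne volume (-1)
    filter_upwards [h0, h1] with x hx0 hx1
    rcases lt_or_gt_of_ne hx1 with h | h
    · exact Or.inl (Or.inl h)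
    · rcases lt_or_gt_of_ne hx0 with h' | h'
      · exact Or.inl (Or.inr ⟨h, h'⟩)
      · exact Or.inr h'
  have hr := Measure.restrict_eq_self_of_ae_mem hae
  constructor
  · rw [← integrableOn_univ, IntegrableOn, Measure.restrict_univ, ← hr]
    exact (i3.union i1).union i2
  · rw [← hr, setIntegral_union _ measurableSet_Ioi (i3.union i1) i2,
      setIntegral_union _ measurableSet_Ioo i3 i1, v1, v2, v3, one_mul]
    · rw [Set.disjoint_left]; intro x hx hx'; exact lt_asymm hx.out hx'.1
    · rw [Set.disjoint_left]
      rintro x (hx | hx) hx'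
      · have := hx.out; have := hx'.out; linarith
      · exact lt_asymm hx.2 hx'.out

/-- Below the axis the integrand has no singularity, so Cauchy's theorem applies on each segment and
R → ∞ gives the whole line; the shift ε is removed afterwards by dominated convergence. -/
theorem integral_lineIntegrand_sub_eq_zero {z : ℂ} (hz : 0 < z.im) {ε : ℝ} (hε : 0 < ε) :
    ∫ x : ℝ, lineIntegrand z (x + (-ε : ℝ) * I) = 0 := by
  have hz0 : 0 < ‖z‖ := norm_pos_iff.2 (by rintro rfl; simp at hz)
  have hint : Integrable fun x : ℝ => lineIntegrand z (x + (-ε : ℝ) * I) := by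
    refine (integrable_lineIntegrand_and_integral hz).1.mono ?_ ?_
    · apply Continuous.aestronglyMeasurable
      rw [continuous_iff_continuousAt]
      intro x
      exact ContinuousAt.comp (f := fun x : ℝ => (x : ℂ) + (-ε : ℝ) * I)
        (differentiableAt_lineIntegrand hz (by simpa using hε)).continuousAt (by fun_prop)
    · filter_upwards [Measure.ae_ne volume 0, Measure.ae_ne volume (-1)] with x h0 h1
      exact norm_lineIntegrand_sub_le hz hε h0 h1
  have ht := intervalIntegral_tendsto_integral hint tendsto_neg_atTop_atBot tendsto_id
  refine tendsto_nhds_unique ht ?_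
  apply squeeze_zero_norm' (a := fun R : ℝ => 8 / (√‖z‖ * √R))
  · filter_upwards [eventually_ge_atTop 2, eventually_ge_atTop (2 / ‖z‖)] with R h1 h2
    exact norm_intervalIntegral_lineIntegrand_le hz hε h1 (by
      rw [div_le_iff₀ hz0] at h2; linarith)
  · apply Tendsto.const_div_atTop
    exact Tendsto.const_mul_atTop (Real.sqrt_pos.2 hz0) Real.tendsto_sqrt_atTop

theorem integral_lineIntegrand_eq_zero {z : ℂ} (hz : 0 < z.im) :
    ∫ x : ℝ, lineIntegrand z x = 0 := by
  have ht : Tendsto (fun ε : ℝ => ∫ x : ℝ, lineIntegrand z (x + (-ε : ℝ) * I)) (𝓝[>] 0)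
      (𝓝 (∫ x : ℝ, lineIntegrand z x)) := by
    apply tendsto_integral_filter_of_dominated_convergence (fun x : ℝ => ‖lineIntegrand z x‖)
    · filter_upwards [self_mem_nhdsWithin] with ε hε
      apply Continuous.aestronglyMeasurable
      rw [continuous_iff_continuousAt]
      intro x
      exact ContinuousAt.comp (f := fun x : ℝ => (x : ℂ) + (-ε : ℝ) * I)
        (differentiableAt_lineIntegrand hz (by simpa using hε)).continuousAt (by fun_prop)
    · filter_upwards [self_mem_nhdsWithin] with ε hε
      filter_upwards [Measure.ae_ne volume 0, Measure.ae_ne volume (-1)] with x h0 h1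
      exact norm_lineIntegrand_sub_le hz hε h0 h1
    · exact (integrable_lineIntegrand_and_integral hz).1.norm
    · filter_upwards [Measure.ae_ne volume 0, Measure.ae_ne volume (-1)] with x h0 h1
      have hc : ContinuousAt (lineIntegrand z) ((x : ℂ) + (-(0 : ℝ) : ℝ) * I) := by
        apply continuousAt_lineIntegrand hz (by simp)
        · exact mem_slitPlane_of_im_ne_zero (by simpa using h0)
        · refine mem_slitPlane_of_im_ne_zero ?_
          simp only [mul_im, I_im, I_re]
          simp
          intro h; exact h1 (by linarith)
      have := ContinuousAt.comp (f := fun ε : ℝ => (x : ℂ) + (-ε : ℝ) * I) hc (by fun_prop)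
      have h2 := this.tendsto.mono_left (nhdsWithin_le_nhds (s := Ioi 0))
      simpa [Function.comp_def] using h2
  refine tendsto_nhds_unique ht ((tendsto_const_nhds (x := (0 : ℂ))).congr' ?_)
  filter_upwards [self_mem_nhdsWithin] with ε hε
  exact (integral_lineIntegrand_sub_eq_zero hz hε).symm

/-- The connection formula for `F(1 - z)` across the negative real axis. -/
theorem arcsineMean_connection {z : ℂ} (hz : 0 < z.im) :
    (arcsineMean fun t => 1 - t * (1 - z)) =
      (arcsineMean fun t => t - z) - I * arcsineMean fun t => 1 - t * z := by
  have h := (integrable_lineIntegrand_and_integral hz).2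
  rw [integral_lineIntegrand_eq_zero hz] at h
  have hpi : (Real.pi : ℂ) ≠ 0 := by exact_mod_cast Real.pi_ne_zero
  apply mul_left_cancel₀ hpi
  linear_combination (-I) * h + (Real.pi * (arcsineMean fun t => 1 - t * (1 - z)) -
    Real.pi * (arcsineMean fun t => t - z)) * I_sq

/-! ### The functions F and B -/

/-- The solution `(1 / π) ∫₀¹ dt / √(t (1 - t) (t - z))` of the hypergeometric equation,
holomorphic on `ℂ ∖ [0, +∞)`. -/
noncomputable def hypB (z : ℂ) : ℂ := arcsineMean fun t => t - z

theorem differentiableOn_hypF : DifferentiableOn ℂ hypF {z | 1 - z ∈ slitPlane} := by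
  have h := differentiableOn_arcsineMean (p := fun _ => 1) (q := fun t => -(t : ℂ))
    (U := {z | 1 - z ∈ slitPlane}) (by fun_prop) (by fun_prop)
    (isOpen_slitPlane.preimage (by fun_prop)) (fun z hz t ht => by
      rw [neg_mul, ← sub_eq_add_neg]
      exact one_sub_mul_mem_slitPlane hz ht)
  refine h.congr fun z _ => ?_
  rw [hypF_eq_arcsineMean]
  simp only [neg_mul, ← sub_eq_add_neg]

theorem differentiableOn_hypB : DifferentiableOn ℂ hypB {z | -z ∈ slitPlane} := by
  have h := differentiableOn_arcsineMean (p := fun t => (t : ℂ)) (q := fun _ => -1)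
    (U := {z | -z ∈ slitPlane}) (by fun_prop) (by fun_prop)
    (isOpen_slitPlane.preimage (by fun_prop)) (fun z hz t ht => by
      rw [neg_one_mul, ← sub_eq_add_neg]
      exact sub_mem_slitPlane hz ht.1)
  refine h.congr fun z _ => ?_
  unfold hypB
  simp only [neg_one_mul, ← sub_eq_add_neg]

theorem hypF_re_pos {z : ℂ} (hz : 1 - z ∈ slitPlane) : 0 < (hypF z).re := by
  rw [hypF_eq_arcsineMean]
  exact arcsineMean_re_pos (by fun_prop) fun t ht => one_sub_mul_mem_slitPlane hz ht

theorem hypF_ne_zero {z : ℂ} (hz : 1 - z ∈ slitPlane) : hypF z ≠ 0 := by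
  intro h
  have := hypF_re_pos hz
  simp [h] at this

theorem hypB_re_pos {z : ℂ} (hz : -z ∈ slitPlane) : 0 < (hypB z).re :=
  arcsineMean_re_pos (by fun_prop) fun _ ht => sub_mem_slitPlane hz ht.1

theorem hypF_conj {z : ℂ} (hz : 1 - z ∈ slitPlane) :
    hypF (starRingEnd ℂ z) = starRingEnd ℂ (hypF z) := by
  rw [hypF_eq_arcsineMean, hypF_eq_arcsineMean,
    ← arcsineMean_conj fun t ht => one_sub_mul_mem_slitPlane hz ht]
  simp

theorem hypB_conj {z : ℂ} (hz : -z ∈ slitPlane) :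
    hypB (starRingEnd ℂ z) = starRingEnd ℂ (hypB z) := by
  unfold hypB
  rw [← arcsineMean_conj fun t ht => sub_mem_slitPlane hz ht.1]
  simp

theorem one_sub_mem_slitPlane_of_im_ne_zero {z : ℂ} (hz : z.im ≠ 0) : 1 - z ∈ slitPlane :=
  mem_slitPlane_of_im_ne_zero (by simpa using hz)

theorem neg_mem_slitPlane_of_im_ne_zero {z : ℂ} (hz : z.im ≠ 0) : -z ∈ slitPlane :=
  mem_slitPlane_of_im_ne_zero (by simpa using hz)

theorem hypF_im_pos {z : ℂ} (hz : 0 < z.im) : 0 < (hypF z).im := by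
  rw [hypF_eq_arcsineMean]
  refine arcsineMean_im_pos (by fun_prop)
    (fun t ht => one_sub_mul_mem_slitPlane (one_sub_mem_slitPlane_of_im_ne_zero hz.ne') ht) ?_
  intro t ht
  have := mul_pos ht.1 hz
  simpa using this

theorem hypF_one_sub_im_neg {z : ℂ} (hz : 0 < z.im) : (hypF (1 - z)).im < 0 := by
  have h := hypF_im_pos (z := starRingEnd ℂ (1 - z)) (by simpa using hz)
  rw [hypF_conj (by simpa using mem_slitPlane_of_im_ne_zero hz.ne')] at h
  simpa using h

theorem hypB_im_pos {z : ℂ} (hz : 0 < z.im) : 0 < (hypB z).im := by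
  refine arcsineMean_im_pos (by fun_prop)
    (fun t ht => sub_mem_slitPlane (neg_mem_slitPlane_of_im_ne_zero hz.ne') ht.1) ?_
  intro t ht
  simpa using hz

theorem hypF_one_sub {z : ℂ} (hz : 0 < z.im) : hypF (1 - z) = hypB z - I * hypF z := by
  rw [hypF_eq_arcsineMean, hypF_eq_arcsineMean, arcsineMean_connection hz, hypB]

/-- The factors a and b/a lie on opposite sides of the axis, so the branch does not jump in the
product. -/
theorem invSqrt_eq_mul_div {a b : ℂ} (ha : a.im < 0) (hr : 0 < (b / a).im) (hb : b ∈ slitPlane) :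
    invSqrt b = invSqrt a * invSqrt (b / a) := by
  have e : a * (b / a) = b := mul_div_cancel₀ b (by rintro rfl; simp at ha)
  rw [← invSqrt_mul ha hr (by rwa [e]), e]

theorem invSqrt_eq_mul_div' {a b : ℂ} (hb : b.im < 0) (hr : (b / a).im < 0)
    (ha : a ∈ slitPlane) : invSqrt b = invSqrt a * invSqrt (b / a) := by
  have hb0 : b ≠ 0 := by rintro rfl; simp at hb
  have ha0 := slitPlane_ne_zero ha
  have hr' : 0 < (a / b).im := by
    rw [← inv_div, inv_im]
    exact div_pos (by linarith) (normSq_pos.2 (div_ne_zero hb0 ha0))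
  have e : b / a * (a / b) = 1 := by field_simp
  have h1 := invSqrt_eq_mul_div hb hr' ha
  have h2 := invSqrt_mul hr hr' (by rw [e]; exact one_mem_slitPlane)
  rw [e, invSqrt_one] at h2
  linear_combination (-invSqrt (b / a)) * h1 + invSqrt b * h2

/-- The quotient `B / F` maps the upper half-plane to itself. -/
theorem hypB_div_hypF_im_pos {z : ℂ} (hz : 0 < z.im) : 0 < (hypB z / hypF z).im := by
  have hz1 : (1 - z).im < 0 := by simpa using hz
  have hz1s := mem_slitPlane_of_im_ne_zero hz1.ne
  have hz10 := slitPlane_ne_zero hz1s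
  have hn : 0 < normSq (1 - z) := normSq_pos.2 hz10
  -- After dividing by 1 - z, the integrand variable of F lies in the upper half-plane and that of B
  -- in the lower one. The common factor `invSqrt (1 - z)` cancels, leaving a mean in the first
  -- quadrant (B) over one in the fourth (F).
  have r1 : ∀ t : ℝ, ((1 - t * z) / (1 - z)).im = (1 - t) * z.im / normSq (1 - z) := by
    intro t
    rw [div_im]
    simp
    ring
  have r2 : ∀ t : ℝ, ((t - z) / (1 - z)).im = -((1 - t) * z.im / normSq (1 - z)) := by
    intro t
    rw [div_im]
    simp
    ring
  have hpos : ∀ t ∈ Ioo (0 : ℝ) 1, 0 < (1 - t) * z.im / normSq (1 - z) := fun t ht =>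
    div_pos (mul_pos (sub_pos.2 ht.2) hz) hn
  have hs1 : ∀ t ∈ Icc (0 : ℝ) 1, (1 - t * z) / (1 - z) ∈ slitPlane := by
    intro t ht
    rcases eq_or_lt_of_le ht.2 with rfl | h
    · simp [div_self hz10]
    · apply mem_slitPlane_of_im_ne_zero
      rw [r1]
      exact (div_pos (mul_pos (sub_pos.2 h) hz) hn).ne'
  have hs2 : ∀ t ∈ Icc (0 : ℝ) 1, (t - z) / (1 - z) ∈ slitPlane := by
    intro t ht
    rcases eq_or_lt_of_le ht.2 with rfl | h
    · simp [div_self hz10]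
    · apply mem_slitPlane_of_im_ne_zero
      rw [r2]
      exact (neg_neg_of_pos (div_pos (mul_pos (sub_pos.2 h) hz) hn)).ne
  have eF : hypF z = invSqrt (1 - z) * arcsineMean fun t => (1 - t * z) / (1 - z) := by
    rw [hypF_eq_arcsineMean]
    refine arcsineMean_mul fun t ht => invSqrt_eq_mul_div hz1 ?_ ?_
    · rw [r1]; exact hpos t ht
    · exact one_sub_mul_mem_slitPlane hz1s (Ioo_subset_Icc_self ht)
  have eB : hypB z = invSqrt (1 - z) * arcsineMean fun t => (t - z) / (1 - z) := by
    refine arcsineMean_mul fun t ht => invSqrt_eq_mul_div' (by simpa using hz) ?_ hz1s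
    rw [r2]; exact neg_neg_of_pos (hpos t ht)
  have e0 : invSqrt (1 - z) ≠ 0 := by
    intro h
    have := invSqrt_re_pos hz1s
    simp [h] at this
  rw [eF, eB, mul_div_mul_left _ _ e0, div_im]
  have f1 := arcsineMean_re_pos (by fun_prop) hs1
  have f2 := arcsineMean_im_neg (by fun_prop) hs1 fun t ht => by rw [r1]; exact hpos t ht
  have b1 := arcsineMean_re_pos (by fun_prop) hs2
  have b2 := arcsineMean_im_pos (by fun_prop) hs2 fun t ht => by
    rw [r2]; exact neg_neg_of_pos (hpos t ht)
  have hn' : 0 < normSq (arcsineMean fun t => (1 - t * z) / (1 - z)) := normSq_pos.2 (by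
    intro h
    rw [h] at f1
    exact lt_irrefl _ f1)
  rw [← sub_div]
  apply div_pos _ hn'
  have := mul_pos b2 f1
  have := mul_neg_of_pos_of_neg b1 f2
  linarith

/-- Both B and F lie in the open first quadrant. -/
theorem hypB_div_hypF_re_pos {z : ℂ} (hz : 0 < z.im) : 0 < (hypB z / hypF z).re := by
  have h1 := hypB_re_pos (neg_mem_slitPlane_of_im_ne_zero hz.ne')
  have h2 := hypB_im_pos hz
  have h3 := hypF_re_pos (one_sub_mem_slitPlane_of_im_ne_zero hz.ne')
  have h4 := hypF_im_pos hz
  have hn := normSq_pos.2 (hypF_ne_zero (one_sub_mem_slitPlane_of_im_ne_zero hz.ne'))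
  rw [div_re]
  positivity

/-! ### The triangle function maps into the quadrilateral -/

/-- The connection formula divided by F. Together with its mirror image, where 1 becomes -1, it
exhibits the jump by 2 across the negative axis. -/
theorem schwarzTriangle_of_im_pos {z : ℂ} (hz : 0 < z.im) :
    schwarzTriangle z = 1 + I * (hypB z / hypF z) := by
  unfold schwarzTriangle
  rw [hypF_one_sub hz]
  have h := hypF_ne_zero (one_sub_mem_slitPlane_of_im_ne_zero hz.ne')
  field_simp
  linear_combination (-hypF z) * I_sq

theorem schwarzTriangle_conj {z : ℂ} (hz : z ∈ slitPlane) (hz' : 1 - z ∈ slitPlane) :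
    schwarzTriangle (starRingEnd ℂ z) = -starRingEnd ℂ (schwarzTriangle z) := by
  unfold schwarzTriangle
  have e : (1 : ℂ) - starRingEnd ℂ z = starRingEnd ℂ (1 - z) := by simp
  rw [e, hypF_conj hz', hypF_conj (by simpa using hz)]
  simp

theorem schwarzTriangle_of_im_neg {z : ℂ} (hz : z.im < 0) :
    schwarzTriangle z = -1 + I * (hypB z / hypF z) := by
  have hs := mem_slitPlane_of_im_ne_zero hz.ne
  have hs1 := one_sub_mem_slitPlane_of_im_ne_zero hz.ne
  have hs2 := neg_mem_slitPlane_of_im_ne_zero hz.ne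
  have h := schwarzTriangle_of_im_pos (z := starRingEnd ℂ z) (by simpa using hz)
  rw [schwarzTriangle_conj hs hs1, hypF_conj hs1, hypB_conj hs2] at h
  have h2 := congrArg (starRingEnd ℂ) h
  simp only [map_neg, map_add, map_one, map_mul, conj_I, conj_conj, map_div₀] at h2
  linear_combination -h2

theorem schwarzTriangle_one_sub (z : ℂ) :
    schwarzTriangle (1 - z) = -1 / schwarzTriangle z := by
  unfold schwarzTriangle
  rw [sub_sub_cancel, div_mul_eq_div_div, neg_div, one_div, inv_I, neg_neg, div_div_eq_mul_div,
    mul_div_assoc]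

/-- The lower bound holds since F(1 - z) is in the fourth quadrant and F(z) in the first; the upper
bound is Im(B/F) > 0. -/
theorem schwarzTriangle_re_mem_of_im_pos {z : ℂ} (hz : 0 < z.im) :
    0 < (schwarzTriangle z).re ∧ (schwarzTriangle z).re < 1 := by
  constructor
  · have h1 := hypF_re_pos (z := 1 - z) (by simpa using mem_slitPlane_of_im_ne_zero hz.ne')
    have h2 := hypF_one_sub_im_neg hz
    have h3 := hypF_re_pos (one_sub_mem_slitPlane_of_im_ne_zero hz.ne')
    have h4 := hypF_im_pos hz
    have hn := normSq_pos.2 (hypF_ne_zero (one_sub_mem_slitPlane_of_im_ne_zero hz.ne'))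
    unfold schwarzTriangle
    rw [I_mul_re, div_im, ← sub_div, ← neg_div]
    apply div_pos _ hn
    have := mul_neg_of_neg_of_pos h2 h3
    have := mul_pos h1 h4
    linarith
  · rw [schwarzTriangle_of_im_pos hz]
    have := hypB_div_hypF_im_pos hz
    rw [add_re, I_mul_re, one_re]
    linarith

theorem mem_slitPlane_of_mem_slitDomain {z : ℂ} (hz : z ∈ slitDomain) :
    z ∈ slitPlane ∧ 1 - z ∈ slitPlane := by
  rcases hz with ⟨x, hx, rfl⟩ | hz
  · refine ⟨ofReal_mem_slitPlane.2 hx.1, ?_⟩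
    have : (1 : ℂ) - (x : ℂ) = ((1 - x : ℝ) : ℂ) := by push_cast; rfl
    simp only [this]
    exact ofReal_mem_slitPlane.2 (sub_pos.2 hx.2)
  · exact ⟨mem_slitPlane_of_im_ne_zero hz, one_sub_mem_slitPlane_of_im_ne_zero hz⟩

theorem one_sub_mem_slitDomain {z : ℂ} (hz : z ∈ slitDomain) : 1 - z ∈ slitDomain := by
  rcases hz with ⟨x, hx, rfl⟩ | hz
  · left
    exact ⟨1 - x, ⟨sub_pos.2 hx.2, by linarith [hx.1]⟩, by push_cast; rfl⟩
  · right
    simpa using hz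

theorem schwarzTriangle_im_pos_and_re {z : ℂ} (hz : z ∈ slitDomain) :
    0 < (schwarzTriangle z).im ∧ -1 < (schwarzTriangle z).re ∧ (schwarzTriangle z).re < 1 := by
  have key : ∀ w : ℂ, 0 < w.im →
      0 < (schwarzTriangle w).im ∧ -1 < (schwarzTriangle w).re ∧ (schwarzTriangle w).re < 1 := by
    intro w hw
    obtain ⟨h1, h2⟩ := schwarzTriangle_re_mem_of_im_pos hw
    refine ⟨?_, by linarith, h2⟩
    rw [schwarzTriangle_of_im_pos hw, add_im, I_mul_im, one_im, zero_add]
    exact hypB_div_hypF_re_pos hw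
  obtain ⟨hs, hs1⟩ := mem_slitPlane_of_mem_slitDomain hz
  rcases lt_trichotomy z.im 0 with h | h | h
  · have := key (starRingEnd ℂ z) (by simpa using h)
    rw [schwarzTriangle_conj hs hs1] at this
    simp only [neg_im, conj_im, neg_neg, neg_re, conj_re] at this
    exact ⟨this.1, by linarith [this.2.2], by linarith [this.2.1]⟩
  · have hc : starRingEnd ℂ z = z := conj_eq_iff_im.2 h
    have hF : (hypF z).im = 0 := by
      rw [← conj_eq_iff_im, ← hypF_conj hs1, hc]
    have hF' : (hypF (1 - z)).im = 0 := by
      rw [← conj_eq_iff_im, ← hypF_conj (by simpa using hs), map_sub, map_one, hc]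
    have h1 := hypF_re_pos hs1
    have h2 := hypF_re_pos (z := 1 - z) (by simpa using hs)
    have hn := normSq_pos.2 (hypF_ne_zero hs1)
    unfold schwarzTriangle
    rw [I_mul_re, I_mul_im, div_re, div_im, hF, hF']
    simp only [mul_zero, zero_mul, zero_div, add_zero, sub_zero, neg_zero]
    exact ⟨by positivity, by norm_num, by norm_num⟩
  · exact key z h

/-- The conditions |2w ∓ 1| > 1 say |Re(-1/w)| < 1, and -1/i_e(z) = i_e(1 - z), so the strip bound
at 1 - z gives them. -/
theorem schwarzTriangle_mem_fundamentalQuadrilateral {z : ℂ} (hz : z ∈ slitDomain) :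
    schwarzTriangle z ∈ fundamentalQuadrilateral := by
  obtain ⟨h1, h2, h3⟩ := schwarzTriangle_im_pos_and_re hz
  obtain ⟨-, h5, h6⟩ := schwarzTriangle_im_pos_and_re (one_sub_mem_slitDomain hz)
  rw [schwarzTriangle_one_sub, neg_div, one_div, neg_re, inv_re] at h5 h6
  have hn : 0 < normSq (schwarzTriangle z) := normSq_pos.2 (by intro h; simp [h] at h1)
  have h7 : (schwarzTriangle z).re < normSq (schwarzTriangle z) := by
    rw [← div_lt_one hn]; linarith
  have h8 : -normSq (schwarzTriangle z) < (schwarzTriangle z).re := by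
    rw [← neg_lt_neg_iff, neg_neg, ← div_lt_one hn, neg_div]; linarith
  rw [normSq_apply] at h7 h8
  refine ⟨h1, h2, h3, ?_, ?_⟩
  · rw [← one_lt_sq_iff₀ (norm_nonneg _), ← normSq_eq_norm_sq, normSq_apply]
    simp
    linarith
  · rw [← one_lt_sq_iff₀ (norm_nonneg _), ← normSq_eq_norm_sq, normSq_apply]
    simp
    linarith

/-! ### The symmetry z ↦ 1/z -/

theorem hypF_eq_invSqrt_mul_hypB_inv {z : ℂ} (hz : 0 < z.im) :
    hypF z = invSqrt (-z) * hypB z⁻¹ := by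
  rw [hypF_eq_arcsineMean]
  have hz0 : z ≠ 0 := by rintro rfl; simp at hz
  refine arcsineMean_mul fun t ht => ?_
  have e : 1 - t * z = -z * (t - z⁻¹) := by field_simp; ring
  have hi : 0 < ((t : ℂ) - z⁻¹).im := by
    rw [sub_im, ofReal_im, inv_im, zero_sub, neg_div, neg_neg]
    exact div_pos hz (normSq_pos.2 hz0)
  have hs := one_sub_mul_mem_slitPlane (one_sub_mem_slitPlane_of_im_ne_zero hz.ne')
    (Ioo_subset_Icc_self ht)
  rw [e] at hs ⊢
  exact invSqrt_mul (by simpa using hz) hi hs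

theorem inv_im_neg {z : ℂ} (hz : 0 < z.im) : z⁻¹.im < 0 := by
  rw [inv_im]
  exact div_neg_of_neg_of_pos (by linarith)
    (normSq_pos.2 (by rintro rfl; simp at hz))

/-- F(z) = B(1/z)/√(-z) and F(1/z) = B(z)/√(-1/z), and the two root factors multiply to 1. The
second identity is the first one at the conjugate of 1/z, because 1/z itself lies in the lower
half-plane. -/
theorem hypF_mul_hypF_inv {z : ℂ} (hz : 0 < z.im) :
    hypF z * hypF z⁻¹ = hypB z * hypB z⁻¹ := by
  have hz0 : z ≠ 0 := by rintro rfl; simp at hz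
  have hi := inv_im_neg hz
  set w := starRingEnd ℂ z⁻¹ with hw
  have hwi : 0 < w.im := by rw [hw, conj_im]; linarith
  have h1 := hypF_eq_invSqrt_mul_hypB_inv hz
  have h2 := hypF_eq_invSqrt_mul_hypB_inv hwi
  have e1 : -w = starRingEnd ℂ (-z⁻¹) := by rw [hw, map_neg]
  have e2 : w⁻¹ = starRingEnd ℂ z := by rw [hw, map_inv₀, inv_inv]
  rw [e1, e2, hw, hypF_conj (one_sub_mem_slitPlane_of_im_ne_zero hi.ne),
    hypB_conj (neg_mem_slitPlane_of_im_ne_zero hz.ne'),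
    invSqrt_conj (neg_mem_slitPlane_of_im_ne_zero hi.ne), ← map_mul] at h2
  have h3 := (starRingEnd ℂ).injective h2
  have e3 : -z * -z⁻¹ = 1 := by field_simp
  have h4 := invSqrt_mul (a := -z) (b := -z⁻¹) (by simpa using hz)
    (by rw [neg_im]; linarith) (by rw [e3]; exact one_mem_slitPlane)
  rw [e3, invSqrt_one] at h4
  rw [h1, h3]
  linear_combination (-hypB z * hypB z⁻¹) * h4

/-- Reduces the behaviour at infinity, where `i_e` tends to a cusp ±1, to the behaviour at 0. -/
theorem schwarzTriangle_sub_one_mul {z : ℂ} (hz : 0 < z.im) :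
    (schwarzTriangle z - 1) * (schwarzTriangle z⁻¹ + 1) = -1 := by
  have hi := inv_im_neg hz
  have h1 := hypF_ne_zero (one_sub_mem_slitPlane_of_im_ne_zero hz.ne')
  have h2 := hypF_ne_zero (one_sub_mem_slitPlane_of_im_ne_zero hi.ne)
  rw [schwarzTriangle_of_im_pos hz, schwarzTriangle_of_im_neg hi]
  have h := hypF_mul_hypF_inv hz
  have e : (1 + I * (hypB z / hypF z) - 1) * (-1 + I * (hypB z⁻¹ / hypF z⁻¹) + 1) =
      I ^ 2 * (hypB z * hypB z⁻¹ / (hypF z * hypF z⁻¹)) := by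
    field_simp
    ring
  rw [e, ← h, div_self (mul_ne_zero h1 h2), I_sq, mul_one]

theorem schwarzTriangle_add_one_mul {z : ℂ} (hz : z.im < 0) :
    (schwarzTriangle z + 1) * (schwarzTriangle z⁻¹ - 1) = -1 := by
  have hz0 : z ≠ 0 := by rintro rfl; simp at hz
  have hi : 0 < z⁻¹.im := by
    rw [inv_im]
    exact div_pos (by linarith) (normSq_pos.2 hz0)
  have h := schwarzTriangle_sub_one_mul hi
  rw [inv_inv] at h
  rw [mul_comm, h]

/-! ### Logarithmic bounds near 0 -/

theorem norm_intervalIntegral_le_sub_of_hasDerivAt {f : ℝ → ℂ} {G g : ℝ → ℝ} {a b : ℝ}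
    (hab : a ≤ b) (hG : ContinuousOn G (Icc a b)) (hd : ∀ t ∈ Ioo a b, HasDerivAt G (g t) t)
    (hf : ∀ t ∈ Ioo a b, ‖f t‖ ≤ g t) : ‖∫ t in a..b, f t‖ ≤ G b - G a := by
  have hint : IntervalIntegrable g volume a b := by
    rw [intervalIntegrable_iff_integrableOn_Ioc_of_le hab]
    exact intervalIntegral.integrableOn_deriv_of_nonneg hG hd
      fun t ht => (norm_nonneg _).trans (hf t ht)
  rw [← intervalIntegral.integral_eq_sub_of_hasDerivAt_of_le hab hG hd hint]
  refine intervalIntegral.norm_integral_le_of_norm_le hab ?_ hint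
  filter_upwards [Measure.ae_ne volume b] with t htb ht
  exact hf t ⟨ht.1, lt_of_le_of_ne ht.2 htb⟩

/-- Splitting at t = r, the second bound on m makes the part over (0, r) at most 4, and the first
makes the part over (r, 1) at most -log r + 2. The leading coefficient 1 must be sharp, since it is
exponentiated later. -/
theorem norm_arcsineMean_le {m : ℝ → ℂ} {r : ℝ} (hr : 0 < r) (hr' : r ≤ 1 / 2)
    (hm : Continuous m) (hs : ∀ t ∈ Icc (0 : ℝ) 1, m t ∈ slitPlane)
    (h1 : ∀ t ∈ Ioo (0 : ℝ) 1, t ≤ ‖m t‖) (h2 : ∀ t ∈ Ioo (0 : ℝ) 1, (1 - t) * r ≤ ‖m t‖) :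
    Real.pi * ‖arcsineMean m‖ ≤ -Real.log r + 6 := by
  have hint := intervalIntegrable_arcsineWeight_mul (continuousOn_invSqrt_comp hm hs)
  have hsub1 : uIcc 0 r ⊆ uIcc (0 : ℝ) 1 := by
    rw [uIcc_of_le hr.le, uIcc_of_le zero_le_one]
    exact Icc_subset_Icc_right (by linarith)
  have hsub2 : uIcc r 1 ⊆ uIcc (0 : ℝ) 1 := by
    rw [uIcc_of_le (by linarith), uIcc_of_le zero_le_one]
    exact Icc_subset_Icc_left hr.le
  have hnorm : ∀ t, ‖(arcsineWeight t : ℂ) * invSqrt (m t)‖ = arcsineWeight t * (1 / √‖m t‖) := by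
    intro t
    rw [norm_mul, norm_invSqrt, norm_real, Real.norm_of_nonneg (arcsineWeight_nonneg t)]
  have e : Real.pi * ‖arcsineMean m‖ =
      ‖(∫ t in (0 : ℝ)..r, (arcsineWeight t : ℂ) * invSqrt (m t)) +
        ∫ t in r..1, (arcsineWeight t : ℂ) * invSqrt (m t)‖ := by
    rw [intervalIntegral.integral_add_adjacent_intervals (hint.mono_set hsub1)
      (hint.mono_set hsub2)]
    unfold arcsineMean
    rw [norm_mul, norm_div, norm_one, norm_real, Real.norm_of_nonneg Real.pi_pos.le,
      ← mul_assoc, mul_one_div_cancel Real.pi_ne_zero, one_mul]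
  have b1 : ‖∫ t in (0 : ℝ)..r, (arcsineWeight t : ℂ) * invSqrt (m t)‖ ≤
      4 / √r * √r - 4 / √r * √0 := by
    apply norm_intervalIntegral_le_sub_of_hasDerivAt (G := fun t => 4 / √r * √t)
      (g := fun t => 4 / √r * (1 / (2 * √t))) hr.le (by fun_prop)
    · intro t ht
      exact (Real.hasDerivAt_sqrt ht.1.ne').const_mul _
    · intro t ht
      have ht1 : t < 1 := by linarith [ht.2]
      have ht2 : 1 / 2 ≤ 1 - t := by linarith [ht.2]
      have ht0 := ht.1
      have ht3 : 0 < 1 - t := by linarith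
      rw [hnorm]
      unfold arcsineWeight
      calc 1 / √(t * (1 - t)) * (1 / √‖m t‖)
          ≤ 1 / √(t * (1 - t)) * (1 / √((1 - t) * r)) := by
            gcongr
            exact h2 t ⟨ht0, ht1⟩
        _ = 1 / (√t * (1 - t) * √r) := by
            have := Real.mul_self_sqrt ht3.le
            rw [Real.sqrt_mul ht0.le, Real.sqrt_mul ht3.le, div_mul_div_comm, one_mul]
            congr 1
            linear_combination √t * √r * this
        _ ≤ 1 / (√t * (1 / 2) * √r) := by gcongr
        _ = 4 / √r * (1 / (2 * √t)) := by
            have := Real.sqrt_pos.2 ht0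
            have := Real.sqrt_pos.2 hr
            field_simp
            norm_num
  have b2 : ‖∫ t in r..1, (arcsineWeight t : ℂ) * invSqrt (m t)‖ ≤
      (Real.log 1 - 2 * √(1 - 1)) - (Real.log r - 2 * √(1 - r)) := by
    apply norm_intervalIntegral_le_sub_of_hasDerivAt (G := fun t => Real.log t - 2 * √(1 - t))
      (g := fun t => t⁻¹ - 2 * (-1 / (2 * √(1 - t)))) (by linarith)
    · apply ContinuousOn.sub _ (by fun_prop)
      exact Real.continuousOn_log.mono fun t ht => (hr.trans_le ht.1).ne'
    · intro t ht
      have ht0 : 0 < t := hr.trans ht.1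
      have ht3 : 0 < 1 - t := by linarith [ht.2]
      exact (Real.hasDerivAt_log ht0.ne').sub
        ((((hasDerivAt_id t).const_sub 1).sqrt ht3.ne').const_mul 2)
    · intro t ht
      have ht0 : 0 < t := hr.trans ht.1
      have ht3 : 0 < 1 - t := by linarith [ht.2]
      have ht4 := Real.sqrt_pos.2 ht3
      rw [hnorm]
      unfold arcsineWeight
      calc 1 / √(t * (1 - t)) * (1 / √‖m t‖)
          ≤ 1 / √(t * (1 - t)) * (1 / √t) := by
            gcongr
            exact h1 t ⟨ht0, ht.2⟩
        _ = 1 / (t * √(1 - t)) := by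
            have := Real.mul_self_sqrt ht0.le
            rw [Real.sqrt_mul ht0.le, div_mul_div_comm, one_mul]
            congr 1
            linear_combination √(1 - t) * this
        -- The inequality 1 ≤ √(1 - t) + t yields a majorant with the elementary antiderivative log
        -- t - 2√(1 - t).
        _ ≤ (√(1 - t) + t) / (t * √(1 - t)) := by
            gcongr
            have h5 := Real.mul_self_sqrt ht3.le
            have h6 : √(1 - t) ≤ 1 := Real.sqrt_le_one.2 (by linarith)
            nlinarith
        _ = t⁻¹ - 2 * (-1 / (2 * √(1 - t))) := by
            field_simp
            ring
  have c1 : 4 / √r * √r = 4 := div_mul_cancel₀ _ (Real.sqrt_pos.2 hr).ne'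
  have c2 : √(1 - r) ≤ 1 := Real.sqrt_le_one.2 (by linarith)
  rw [c1, Real.sqrt_zero] at b1
  rw [Real.log_one, sub_self, Real.sqrt_zero] at b2
  rw [e]
  linarith [norm_add_le (∫ t in (0 : ℝ)..r, (arcsineWeight t : ℂ) * invSqrt (m t))
    (∫ t in r..1, (arcsineWeight t : ℂ) * invSqrt (m t))]

/-- The weight and, up to √2, the real part of the root are both at least (t + r)^(-1/2). This bound
only has to show that `i_e` tends to ∞, so its constant is immaterial. -/
theorem le_norm_arcsineMean {m : ℝ → ℂ} {r : ℝ} (hr : 0 < r)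
    (hm : Continuous m) (hs : ∀ t ∈ Icc (0 : ℝ) 1, m t ∈ slitPlane)
    (h0 : ∀ t ∈ Ioo (0 : ℝ) 1, 0 ≤ (m t).re) (h3 : ∀ t ∈ Ioo (0 : ℝ) 1, ‖m t‖ ≤ t + r) :
    1 / (√2 * Real.pi) * -Real.log r ≤ ‖arcsineMean m‖ := by
  have hpos : ∀ t ∈ Icc (0 : ℝ) 1, t + r ≠ 0 := fun t ht => (add_pos_of_nonneg_of_pos ht.1 hr).ne'
  have hc : ContinuousOn (fun t : ℝ => 1 / √2 * (t + r)⁻¹) (Icc 0 1) :=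
    continuousOn_const.mul (ContinuousOn.inv₀ (by fun_prop) hpos)
  have hi : IntervalIntegrable (fun t : ℝ => 1 / √2 * (t + r)⁻¹) volume 0 1 :=
    ContinuousOn.intervalIntegrable (by rwa [uIcc_of_le zero_le_one])
  have e : ∫ t in (0 : ℝ)..1, 1 / √2 * (t + r)⁻¹ =
      1 / √2 * Real.log (1 + r) - 1 / √2 * Real.log (0 + r) := by
    refine intervalIntegral.integral_eq_sub_of_hasDerivAt
      (f := fun t : ℝ => 1 / √2 * Real.log (t + r)) ?_ hi
    intro t ht
    rw [uIcc_of_le zero_le_one] at ht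
    have := (((hasDerivAt_id t).add_const r).log (hpos t ht)).const_mul (1 / √2)
    simpa using this
  refine le_trans ?_ (re_le_norm _)
  rw [arcsineMean_re m hm hs]
  have hmono : ∫ t in (0 : ℝ)..1, 1 / √2 * (t + r)⁻¹ ≤
      ∫ t in (0 : ℝ)..1, arcsineWeight t * (invSqrt (m t)).re := by
    apply intervalIntegral.integral_mono_on_of_le_Ioo zero_le_one hi
    · apply intervalIntegrable_arcsineWeight.mul_continuousOn
      rw [uIcc_of_le zero_le_one]
      exact continuous_re.comp_continuousOn (continuousOn_invSqrt_comp hm hs)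
    · intro t ht
      have hms := hs t (Ioo_subset_Icc_self ht)
      have i1 := norm_le_sqrt_two_mul_invSqrt_re (h0 t ht) hms
      have hn : 0 < ‖m t‖ := norm_pos_iff.2 (slitPlane_ne_zero hms)
      have ht0 := ht.1
      have ht1 : 0 < 1 - t := sub_pos.2 ht.2
      have htr : 0 < t + r := by linarith
      rw [norm_invSqrt] at i1
      have i2 : 1 / √(t + r) ≤ 1 / √‖m t‖ := by
        gcongr
        exact h3 t ht
      have i3 : 1 / √(t + r) ≤ arcsineWeight t := by
        unfold arcsineWeight
        gcongr
        nlinarith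
      have i4 : 1 / √2 * (1 / √(t + r)) ≤ (invSqrt (m t)).re := by
        rw [one_div_mul_eq_div, div_le_iff₀ (by positivity), mul_comm]
        exact i2.trans i1
      calc 1 / √2 * (t + r)⁻¹ = 1 / √(t + r) * (1 / √2 * (1 / √(t + r))) := by
            have := Real.mul_self_sqrt htr.le
            have h5 : (t + r)⁻¹ = 1 / √(t + r) * (1 / √(t + r)) := by
              rw [div_mul_div_comm, this, one_mul, one_div]
            rw [h5]
            ring
        _ ≤ arcsineWeight t * (invSqrt (m t)).re := by
            gcongr
            exact arcsineWeight_nonneg t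
  rw [e] at hmono
  have hlog : 0 ≤ Real.log (1 + r) := Real.log_nonneg (by linarith)
  rw [zero_add] at hmono
  have h5 : 1 / √2 * -Real.log r ≤
      ∫ t in (0 : ℝ)..1, arcsineWeight t * (invSqrt (m t)).re := by
    have : 0 ≤ 1 / √2 * Real.log (1 + r) := by positivity
    linarith
  calc 1 / (√2 * Real.pi) * -Real.log r = 1 / Real.pi * (1 / √2 * -Real.log r) := by
        field_simp
    _ ≤ _ := by gcongr

theorem mul_norm_le_norm_add {z : ℂ} (hz : 0 ≤ z.re) {t s : ℝ} (ht : 0 ≤ t) (hs : 0 ≤ s) :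
    s * ‖z‖ ≤ ‖(t : ℂ) + s * z‖ := by
  apply le_of_sq_le_sq _ (norm_nonneg _)
  rw [mul_pow, ← normSq_eq_norm_sq, ← normSq_eq_norm_sq, normSq_apply, normSq_apply]
  simp
  nlinarith [mul_nonneg (mul_nonneg ht hs) hz, mul_nonneg ht ht]

theorem le_norm_add {z : ℂ} (hz : 0 ≤ z.re) {t s : ℝ} (hs : 0 ≤ s) :
    t ≤ ‖(t : ℂ) + s * z‖ := by
  refine le_trans ?_ (re_le_norm _)
  simp
  positivity

theorem norm_add_le_add {z : ℂ} {t s : ℝ} (ht : 0 ≤ t) (hs : 0 ≤ s) (hs' : s ≤ 1) :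
    ‖(t : ℂ) + s * z‖ ≤ t + ‖z‖ := by
  refine (norm_add_le _ _).trans ?_
  rw [norm_mul, norm_real, norm_real, Real.norm_of_nonneg ht, Real.norm_of_nonneg hs]
  gcongr
  exact mul_le_of_le_one_left (norm_nonneg z) hs'

/-- Reflecting t turns 1 - t(1 - z) into t + (1 - t)z, which stays away from 0 when Re z ≥ 0. For Re
z ≤ 0 the role is taken by B, with t - z in its place. -/
theorem norm_hypF_one_sub_bounds {z : ℂ} (hz : 0 ≤ z.re) (him : z.im ≠ 0) (hz' : ‖z‖ ≤ 1 / 2) :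
    Real.pi * ‖hypF (1 - z)‖ ≤ -Real.log ‖z‖ + 6 ∧
      1 / (√2 * Real.pi) * -Real.log ‖z‖ ≤ ‖hypF (1 - z)‖ := by
  have hz0 : 0 < ‖z‖ := norm_pos_iff.2 (by rintro rfl; simp at him)
  have e : hypF (1 - z) = arcsineMean fun t => (t : ℂ) + ((1 - t : ℝ) : ℂ) * z := by
    rw [hypF_eq_arcsineMean, ← arcsineMean_reflect]
    refine arcsineMean_congr fun t _ => ?_
    push_cast
    ring
  have hs : ∀ t ∈ Icc (0 : ℝ) 1, (t : ℂ) + ((1 - t : ℝ) : ℂ) * z ∈ slitPlane := by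
    intro t ht
    have := one_sub_mul_mem_slitPlane (z := 1 - z) (t := 1 - t)
      (by simpa using mem_slitPlane_of_im_ne_zero him) ⟨by linarith [ht.2], by linarith [ht.1]⟩
    convert this using 1
    push_cast
    ring
  rw [e]
  refine ⟨norm_arcsineMean_le hz0 hz' (by fun_prop) hs
      (fun t ht => le_norm_add hz (by linarith [ht.2]))
      (fun t ht => mul_norm_le_norm_add hz ht.1.le (by linarith [ht.2])),
    le_norm_arcsineMean hz0 (by fun_prop) hs (fun t ht => ?_)
      (fun t ht => norm_add_le_add ht.1.le (by linarith [ht.2]) (by linarith [ht.1]))⟩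
  have := ht.1
  have := mul_nonneg (sub_pos.2 ht.2).le hz
  simp
  linarith

theorem norm_hypB_bounds {z : ℂ} (hz : z.re ≤ 0) (him : z.im ≠ 0) (hz' : ‖z‖ ≤ 1 / 2) :
    Real.pi * ‖hypB z‖ ≤ -Real.log ‖z‖ + 6 ∧
      1 / (√2 * Real.pi) * -Real.log ‖z‖ ≤ ‖hypB z‖ := by
  have hz0 : 0 < ‖z‖ := norm_pos_iff.2 (by rintro rfl; simp at him)
  have hz1 : 0 ≤ (-z).re := by simpa using hz
  have e : hypB z = arcsineMean fun t => (t : ℂ) + ((1 : ℝ) : ℂ) * -z := by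
    unfold hypB
    refine arcsineMean_congr fun t _ => ?_
    push_cast
    ring
  have hs : ∀ t ∈ Icc (0 : ℝ) 1, (t : ℂ) + ((1 : ℝ) : ℂ) * -z ∈ slitPlane := by
    intro t ht
    have := sub_mem_slitPlane (neg_mem_slitPlane_of_im_ne_zero him) ht.1
    convert this using 1
    push_cast
    ring
  rw [e, ← norm_neg z] at *
  refine ⟨norm_arcsineMean_le hz0 hz' (by fun_prop) hs
      (fun t ht => le_norm_add hz1 zero_le_one)
      (fun t ht => le_trans ?_ (mul_norm_le_norm_add hz1 ht.1.le zero_le_one)),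
    le_norm_arcsineMean hz0 (by fun_prop) hs (fun t ht => ?_)
      (fun t ht => norm_add_le_add ht.1.le zero_le_one le_rfl)⟩
  · gcongr
    linarith [ht.1]
  · have := ht.1
    simp
    linarith

theorem hypF_zero : hypF 0 = 1 := by
  rw [hypF_eq_arcsineMean]
  simp only [mul_zero, sub_zero]
  exact arcsineMean_one

theorem eventually_norm_hypF_inv_le :
    ∃ C : ℝ, 0 ≤ C ∧ ∀ᶠ z in 𝓝 (0 : ℂ), ‖(hypF z)⁻¹‖ ≤ 1 + C * ‖z‖ ∧ ‖hypF z‖ ≤ 2 := by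
  have hd : DifferentiableAt ℂ hypF 0 :=
    differentiableOn_hypF.differentiableAt
      ((isOpen_slitPlane.preimage (by fun_prop : Continuous fun z : ℂ => 1 - z)).mem_nhds (by simp))
  have hi : DifferentiableAt ℂ (fun z => (hypF z)⁻¹) 0 := hd.inv (by simp [hypF_zero])
  obtain ⟨C, hC, hO⟩ := hi.isBigO_sub.exists_nonneg
  refine ⟨C, hC, ?_⟩
  have h2 : ∀ᶠ z in 𝓝 (0 : ℂ), ‖hypF z‖ < 2 :=
    hd.continuousAt.norm.eventually_lt continuousAt_const (by simp [hypF_zero])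
  filter_upwards [hO.bound, h2] with z h1 h2
  refine ⟨?_, h2.le⟩
  rw [hypF_zero, sub_zero, inv_one] at h1
  have := norm_add_le ((hypF z)⁻¹ - 1) 1
  rw [sub_add_cancel, norm_one] at this
  linarith

theorem norm_I_mul_div_bounds {a b : ℂ} {r C : ℝ} (hr : 0 < r) (hr' : r ≤ 1) (hC : 0 ≤ C)
    (ha : Real.pi * ‖a‖ ≤ -Real.log r + 6 ∧ 1 / (√2 * Real.pi) * -Real.log r ≤ ‖a‖)
    (hb : ‖b⁻¹‖ ≤ 1 + C * r ∧ ‖b‖ ≤ 2) (hb0 : b ≠ 0) :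
    Real.pi * ‖I * (a / b)‖ ≤ -Real.log r + (6 + 7 * C) ∧
      1 / (√2 * Real.pi) * -Real.log r / 2 ≤ ‖I * (a / b)‖ := by
  rw [norm_mul, norm_I, one_mul]
  have hl : 0 ≤ -Real.log r := neg_nonneg.2 (Real.log_nonpos hr.le hr')
  -- Dividing by F = 1 + O(r) costs only a constant: C r(-log r) + 6Cr ≤ 7C.
  have hl' : r * -Real.log r ≤ 1 := by
    have := Real.abs_log_mul_self_lt r hr hr'
    have := (abs_lt.1 this).1
    linarith
  constructor
  · rw [div_eq_mul_inv, norm_mul, ← mul_assoc]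
    calc Real.pi * ‖a‖ * ‖b⁻¹‖ ≤ (-Real.log r + 6) * (1 + C * r) := by
          gcongr
          · exact ha.1
          · exact hb.1
      _ ≤ -Real.log r + (6 + 7 * C) := by
          nlinarith [mul_le_mul_of_nonneg_left hl' hC, mul_le_mul_of_nonneg_left hr' hC]
  · rw [norm_div]
    have : 0 < ‖b‖ := norm_pos_iff.2 hb0
    gcongr
    · exact ha.2
    · exact hb.2

/-- In the right half-plane the definition is estimated directly, in the left one the form ±1 +
iB/F; the summand ±1 accounts for the extra π and for the -1. -/
theorem eventually_norm_schwarzTriangle_bounds :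
    ∃ C : ℝ, ∀ᶠ z in 𝓝[{z : ℂ | z.im ≠ 0}] 0,
      Real.pi * ‖schwarzTriangle z‖ ≤ -Real.log ‖z‖ + C ∧
        1 / (√2 * Real.pi) * -Real.log ‖z‖ / 2 - 1 ≤ ‖schwarzTriangle z‖ := by
  obtain ⟨C, hC, hF⟩ := eventually_norm_hypF_inv_le
  refine ⟨6 + 7 * C + Real.pi, ?_⟩
  have hball : ∀ᶠ z in 𝓝 (0 : ℂ), ‖z‖ < 1 / 2 :=
    continuousAt_id.norm.eventually_lt continuousAt_const (by simp)
  filter_upwards [self_mem_nhdsWithin, nhdsWithin_le_nhds hF, nhdsWithin_le_nhds hball]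
    with z him hFz hz
  have hz0 : 0 < ‖z‖ := norm_pos_iff.2 (by rintro rfl; simp at him)
  have hb0 := hypF_ne_zero (one_sub_mem_slitPlane_of_im_ne_zero him)
  have hpi := Real.pi_pos
  have hz1 : ‖z‖ ≤ 1 := by linarith
  rcases le_total 0 z.re with h | h
  · have := norm_I_mul_div_bounds hz0 hz1 hC (norm_hypF_one_sub_bounds h him hz.le) hFz hb0
    unfold schwarzTriangle
    exact ⟨by linarith, by linarith⟩
  · have := norm_I_mul_div_bounds hz0 hz1 hC (norm_hypB_bounds h him hz.le) hFz hb0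
    have key : ∀ c : ℂ, ‖c‖ = 1 → schwarzTriangle z = c + I * (hypB z / hypF z) →
        Real.pi * ‖schwarzTriangle z‖ ≤ -Real.log ‖z‖ + (6 + 7 * C + Real.pi) ∧
        1 / (√2 * Real.pi) * -Real.log ‖z‖ / 2 - 1 ≤ ‖schwarzTriangle z‖ := by
      intro c hc e
      have i1 := norm_add_le c (I * (hypB z / hypF z))
      have i2 := norm_sub_le (c + I * (hypB z / hypF z)) c
      rw [add_sub_cancel_left] at i2
      rw [e]
      rw [hc] at i1 i2
      constructor
      · nlinarith
      · linarith
    rcases lt_or_gt_of_ne him with h' | h'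
    · exact key (-1) (by simp) (schwarzTriangle_of_im_neg h')
    · exact key 1 (by simp) (schwarzTriangle_of_im_pos h')

theorem eventually_exp_norm_schwarzTriangle_le :
    ∃ K : ℝ, 0 < K ∧ ∀ᶠ z in 𝓝[{z : ℂ | z.im ≠ 0}] 0,
      Real.exp (Real.pi * ‖schwarzTriangle z‖) ≤ K * ‖z‖⁻¹ := by
  obtain ⟨C, hC⟩ := eventually_norm_schwarzTriangle_bounds
  refine ⟨Real.exp C, Real.exp_pos C, ?_⟩
  filter_upwards [hC, self_mem_nhdsWithin] with z hz him
  have hz0 : 0 < ‖z‖ := norm_pos_iff.2 (by rintro rfl; simp at him)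
  have := Real.exp_le_exp.2 hz.1
  rwa [add_comm, Real.exp_add, Real.exp_neg, Real.exp_log hz0] at this

theorem tendsto_schwarzTriangle_zero :
    Tendsto schwarzTriangle (𝓝[{z : ℂ | z.im ≠ 0}] 0) (Bornology.cobounded ℂ) := by
  obtain ⟨C, hC⟩ := eventually_norm_schwarzTriangle_bounds
  rw [← tendsto_norm_atTop_iff_cobounded]
  refine tendsto_atTop_mono' _ (hC.mono fun z hz => hz.2) ?_
  have h1 : Tendsto (fun z : ℂ => ‖z‖) (𝓝[{z : ℂ | z.im ≠ 0}] 0) (𝓝[>] 0) := by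
    rw [tendsto_nhdsWithin_iff]
    refine ⟨by simpa using (continuous_norm.tendsto (0 : ℂ)).mono_left nhdsWithin_le_nhds, ?_⟩
    filter_upwards [self_mem_nhdsWithin] with z him
    exact norm_pos_iff.2 (by rintro rfl; simp at him)
  have h2 := tendsto_neg_atBot_atTop.comp (Real.tendsto_log_nhdsGT_zero.comp h1)
  have h3 := (h2.const_mul_atTop (show 0 < 1 / (√2 * Real.pi) by positivity)).atTop_div_const
    (show (0 : ℝ) < 2 by norm_num)
  exact tendsto_atTop_add_const_right _ (-1) h3

/-! ### Transfer of the growth conditions -/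

theorem exp_mul_le_pow {x a : ℝ} (n : ℕ) (h : Real.exp (Real.pi * x) ≤ a) :
    Real.exp (Real.pi * ((n : ℝ) + 1) * x) ≤ a ^ (n + 1) := by
  have : Real.pi * ((n : ℝ) + 1) * x = ((n + 1 : ℕ) : ℝ) * (Real.pi * x) := by push_cast; ring
  rw [this, Real.exp_nat_mul]
  gcongr

theorem schwarzTriangle_mem_of_im_ne_zero {z : ℂ} (hz : z.im ≠ 0) :
    schwarzTriangle z ∈ fundamentalQuadrilateral :=
  schwarzTriangle_mem_fundamentalQuadrilateral (Or.inr hz)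

theorem isLittleO_comp_schwarzTriangle_zero {f : ℂ → ℂ} {n : ℕ}
    (h : f =o[Bornology.cobounded ℂ ⊓ 𝓟 fundamentalQuadrilateral]
      fun z : ℂ => Real.exp (Real.pi * ((n : ℝ) + 1) * ‖z‖)) :
    (fun z => f (schwarzTriangle z)) =o[𝓝[{z : ℂ | z.im ≠ 0}] 0] fun z => z⁻¹ ^ (n + 1) := by
  have ht : Tendsto schwarzTriangle (𝓝[{z : ℂ | z.im ≠ 0}] 0)
      (Bornology.cobounded ℂ ⊓ 𝓟 fundamentalQuadrilateral) := by
    rw [tendsto_inf, tendsto_principal]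
    refine ⟨tendsto_schwarzTriangle_zero, ?_⟩
    filter_upwards [self_mem_nhdsWithin] with z hz
    exact schwarzTriangle_mem_of_im_ne_zero hz
  refine (h.comp_tendsto ht).trans_isBigO ?_
  obtain ⟨K, hK, hK'⟩ := eventually_exp_norm_schwarzTriangle_le
  apply Asymptotics.IsBigO.of_bound (K ^ (n + 1))
  filter_upwards [hK'] with z hz
  rw [Function.comp, Real.norm_of_nonneg (Real.exp_pos _).le, norm_pow, norm_inv, ← mul_pow]
  exact exp_mul_le_pow n hz

theorem isLittleO_comp_schwarzTriangle_one {f : ℂ → ℂ} {n : ℕ}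
    (h : f =o[𝓝[fundamentalQuadrilateral] 0]
      fun z : ℂ => Real.exp (Real.pi * ((n : ℝ) + 1) * ‖z‖⁻¹)) :
    (fun z => f (schwarzTriangle z)) =o[𝓝[{z : ℂ | z.im ≠ 0}] 1] fun z => (1 - z)⁻¹ ^ (n + 1) := by
  have ht1 : Tendsto (fun z : ℂ => 1 - z) (𝓝[{z : ℂ | z.im ≠ 0}] 1) (𝓝[{z : ℂ | z.im ≠ 0}] 0) := by
    rw [tendsto_nhdsWithin_iff]
    constructor
    · have : ContinuousAt (fun z : ℂ => 1 - z) 1 := by fun_prop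
      simpa using this.tendsto.mono_left nhdsWithin_le_nhds
    · filter_upwards [self_mem_nhdsWithin] with z hz
      simpa using hz
  have e : ∀ z, schwarzTriangle z = -(schwarzTriangle (1 - z))⁻¹ := by
    intro z
    have := schwarzTriangle_one_sub (1 - z)
    rwa [sub_sub_cancel, neg_div, one_div] at this
  have ht : Tendsto schwarzTriangle (𝓝[{z : ℂ | z.im ≠ 0}] 1)
      (𝓝[fundamentalQuadrilateral] 0) := by
    rw [tendsto_nhdsWithin_iff]
    constructor
    · have := (tendsto_inv₀_cobounded.comp (tendsto_schwarzTriangle_zero.comp ht1)).neg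
      rw [neg_zero] at this
      exact this.congr fun z => (e z).symm
    · filter_upwards [self_mem_nhdsWithin] with z hz
      exact schwarzTriangle_mem_of_im_ne_zero hz
  refine (h.comp_tendsto ht).trans_isBigO ?_
  obtain ⟨K, hK, hK'⟩ := eventually_exp_norm_schwarzTriangle_le
  apply Asymptotics.IsBigO.of_bound (K ^ (n + 1))
  filter_upwards [ht1.eventually hK'] with z hz
  rw [Function.comp, Real.norm_of_nonneg (Real.exp_pos _).le, norm_pow, norm_inv, ← mul_pow]
  apply exp_mul_le_pow n
  rwa [e z, norm_neg, norm_inv, inv_inv]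

/-- The relation gives 1/|i_e(z) - σ| = |i_e(1/z) + σ| ≤ |i_e(1/z)| + 1, so the estimate at 0
applies with an extra factor e^π. The set S is a half-plane, because σ is 1 above the axis and -1
below it. -/
theorem isLittleO_comp_schwarzTriangle_infty_aux {f : ℂ → ℂ} {n : ℕ} {σ : ℂ} (hσ : ‖σ‖ = 1)
    {S : Set ℂ} (hS : ∀ z ∈ S, z.im ≠ 0)
    (hrel : ∀ z ∈ S, (schwarzTriangle z - σ) * (schwarzTriangle z⁻¹ + σ) = -1)
    (h : f =o[𝓝[fundamentalQuadrilateral] σ]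
      fun z : ℂ => Real.exp (Real.pi * ((n : ℝ) + 1) * ‖z - σ‖⁻¹)) :
    (fun z => f (schwarzTriangle z)) =o[Bornology.cobounded ℂ ⊓ 𝓟 S] fun z => z ^ (n + 1) := by
  have hmem : ∀ᶠ z in Bornology.cobounded ℂ ⊓ 𝓟 S, z ∈ S :=
    mem_inf_of_right (mem_principal_self S)
  have ht1 : Tendsto (fun z : ℂ => z⁻¹) (Bornology.cobounded ℂ ⊓ 𝓟 S)
      (𝓝[{z : ℂ | z.im ≠ 0}] 0) := by
    rw [tendsto_nhdsWithin_iff]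
    refine ⟨tendsto_inv₀_cobounded.mono_left inf_le_left, ?_⟩
    filter_upwards [hmem] with z hz
    have h0 : z ≠ 0 := by rintro rfl; exact hS 0 hz rfl
    change z⁻¹.im ≠ 0
    rw [inv_im]
    exact div_ne_zero (neg_ne_zero.2 (hS z hz)) (normSq_pos.2 h0).ne'
  have e : ∀ z ∈ S, schwarzTriangle z - σ = -(schwarzTriangle z⁻¹ + σ)⁻¹ := by
    intro z hz
    have := hrel z hz
    have h0 : schwarzTriangle z⁻¹ + σ ≠ 0 := by
      intro h0
      rw [h0] at this
      simp at this
    rw [inv_eq_one_div, ← neg_div, eq_div_iff h0, this]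
  have ht : Tendsto schwarzTriangle (Bornology.cobounded ℂ ⊓ 𝓟 S)
      (𝓝[fundamentalQuadrilateral] σ) := by
    rw [tendsto_nhdsWithin_iff]
    constructor
    · have h1 : Tendsto (fun z => schwarzTriangle z⁻¹ + σ) (Bornology.cobounded ℂ ⊓ 𝓟 S)
          (Bornology.cobounded ℂ) := by
        rw [← tendsto_norm_atTop_iff_cobounded]
        have h2 := tendsto_norm_cobounded_atTop.comp (tendsto_schwarzTriangle_zero.comp ht1)
        refine tendsto_atTop_mono (fun z => ?_) (tendsto_atTop_add_const_right _ (-1) h2)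
        have := norm_sub_le (schwarzTriangle z⁻¹ + σ) σ
        rw [add_sub_cancel_right, hσ] at this
        simp only [Function.comp]
        linarith
      have h2 := ((tendsto_inv₀_cobounded.comp h1).neg).add_const σ
      rw [neg_zero, zero_add] at h2
      refine h2.congr' ?_
      filter_upwards [hmem] with z hz
      simp only [Function.comp]
      rw [← e z hz, sub_add_cancel]
    · filter_upwards [hmem] with z hz
      exact schwarzTriangle_mem_of_im_ne_zero (hS z hz)
  refine (h.comp_tendsto ht).trans_isBigO ?_
  obtain ⟨K, hK, hK'⟩ := eventually_exp_norm_schwarzTriangle_le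
  apply Asymptotics.IsBigO.of_bound ((Real.exp Real.pi * K) ^ (n + 1))
  filter_upwards [ht1.eventually hK', hmem] with z hz hzS
  rw [Function.comp, Real.norm_of_nonneg (Real.exp_pos _).le, norm_pow, ← mul_pow]
  apply exp_mul_le_pow n
  rw [norm_inv, inv_inv] at hz
  rw [e z hzS, norm_neg, norm_inv, inv_inv, mul_assoc]
  refine le_trans ?_ (mul_le_mul_of_nonneg_left hz (Real.exp_pos _).le)
  rw [← Real.exp_add]
  apply Real.exp_le_exp.2
  have := norm_add_le (schwarzTriangle z⁻¹) σ
  rw [hσ] at this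
  nlinarith [Real.pi_pos]

theorem isLittleO_comp_schwarzTriangle_infty {f : ℂ → ℂ} {n : ℕ}
    (h : ∀ σ : ℂ, σ = 1 ∨ σ = -1 → f =o[𝓝[fundamentalQuadrilateral] σ]
      fun z : ℂ => Real.exp (Real.pi * ((n : ℝ) + 1) * ‖z - σ‖⁻¹)) :
    (fun z => f (schwarzTriangle z)) =o[Bornology.cobounded ℂ ⊓ 𝓟 {z : ℂ | z.im ≠ 0}]
      fun z => z ^ (n + 1) := by
  have h1 := isLittleO_comp_schwarzTriangle_infty_aux (σ := 1) (S := {z : ℂ | 0 < z.im})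
    (by simp) (fun z hz => hz.out.ne') (fun z hz => schwarzTriangle_sub_one_mul hz)
    (h 1 (Or.inl rfl))
  have h2 := isLittleO_comp_schwarzTriangle_infty_aux (σ := -1) (S := {z : ℂ | z.im < 0})
    (by simp) (fun z hz => hz.out.ne) (fun z hz => by
      rw [sub_neg_eq_add, ← sub_eq_add_neg]
      exact schwarzTriangle_add_one_mul hz) (h (-1) (Or.inr rfl))
  have e : Bornology.cobounded ℂ ⊓ 𝓟 {z : ℂ | z.im ≠ 0} =
      (Bornology.cobounded ℂ ⊓ 𝓟 {z : ℂ | 0 < z.im}) ⊔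
        (Bornology.cobounded ℂ ⊓ 𝓟 {z : ℂ | z.im < 0}) := by
    rw [← inf_sup_left, sup_principal]
    congr 2
    ext z
    simp only [mem_ofPred_eq, mem_union]
    rw [or_comm]
    exact ne_iff_lt_or_gt
  rw [e]
  exact h1.sup h2

/-! ### Geometry of the quadrilateral -/

theorem mem_fundamentalQuadrilateral_iff {w : ℂ} : w ∈ fundamentalQuadrilateral ↔
    0 < w.im ∧ |w.re| < 1 ∧ |w.re| < normSq w := by
  have e1 : 1 < ‖2 * w - 1‖ ↔ w.re < normSq w := by
    rw [← one_lt_sq_iff₀ (norm_nonneg _), ← normSq_eq_norm_sq, normSq_apply, normSq_apply]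
    simp
    constructor <;> intro h <;> linarith
  have e2 : 1 < ‖2 * w + 1‖ ↔ -normSq w < w.re := by
    rw [← one_lt_sq_iff₀ (norm_nonneg _), ← normSq_eq_norm_sq, normSq_apply, normSq_apply]
    simp
    constructor <;> intro h <;> linarith
  rw [fundamentalQuadrilateral, mem_ofPred_eq, e1, e2, abs_lt, abs_lt, upperHalfPlane, mem_ofPred_eq]
  tauto

theorem isOpen_fundamentalQuadrilateral : IsOpen fundamentalQuadrilateral := by
  have : fundamentalQuadrilateral =
      {w : ℂ | 0 < w.im} ∩ ({w | |w.re| < 1} ∩ {w | |w.re| < normSq w}) := by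
    ext w
    exact mem_fundamentalQuadrilateral_iff
  rw [this]
  exact (isOpen_lt (by fun_prop) (by fun_prop)).inter
    ((isOpen_lt (by fun_prop) (by fun_prop)).inter
      (isOpen_lt (by fun_prop) continuous_normSq))

theorem neg_one_div_im {w : ℂ} : (-1 / w).im = w.im / normSq w := by
  rw [neg_div, one_div, neg_im, inv_im, neg_div, neg_neg]

theorem neg_one_div_mem_fundamentalQuadrilateral {w : ℂ} (hw : w ∈ fundamentalQuadrilateral) :
    -1 / w ∈ fundamentalQuadrilateral := by
  rw [mem_fundamentalQuadrilateral_iff] at hw ⊢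
  obtain ⟨h1, h2, h3⟩ := hw
  have hn : 0 < normSq w := normSq_pos.2 (by rintro rfl; simp at h1)
  have e1 : |(-1 / w).re| = |w.re| / normSq w := by
    rw [neg_div, one_div, neg_re, inv_re, abs_neg, abs_div, abs_of_pos hn]
  have e2 : normSq (-1 / w) = 1 / normSq w := by simp
  rw [neg_one_div_im, e1, e2]
  refine ⟨div_pos h1 hn, (div_lt_one hn).2 h3, ?_⟩
  gcongr

theorem mapsTo_neg_one_div_closure :
    MapsTo (fun w : ℂ => -1 / w) (upperHalfPlane ∩ closure fundamentalQuadrilateral)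
      (upperHalfPlane ∩ closure fundamentalQuadrilateral) := by
  rintro w ⟨h1, h2⟩
  have h1' : 0 < w.im := h1
  have hw : w ≠ 0 := by rintro rfl; simp at h1'
  constructor
  · change 0 < (-1 / w).im
    rw [neg_one_div_im]
    exact div_pos h1' (normSq_pos.2 hw)
  · have hc : ContinuousAt (fun w : ℂ => -1 / w) w := continuousAt_const.div continuousAt_id hw
    have := hc.continuousWithinAt.mem_closure_image h2
    refine closure_mono ?_ this
    rintro _ ⟨u, hu, rfl⟩
    exact neg_one_div_mem_fundamentalQuadrilateral hu

/-! ### Continuation across the slits -/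

/-- The function `i B / F`, which continues `schwarzTriangle ∓ 1` from the upper and the lower
half-plane across the negative real axis. -/
noncomputable def triangleBranch (z : ℂ) : ℂ := I * (hypB z / hypF z)

theorem continuousOn_triangleBranch : ContinuousOn triangleBranch {z | z.re < 0} := by
  unfold triangleBranch
  apply ContinuousOn.mul continuousOn_const
  have h1 : ∀ z : ℂ, z.re < 0 → 1 - z ∈ slitPlane := fun z hz => by
    left; simp; linarith
  have h2 : ∀ z : ℂ, z.re < 0 → -z ∈ slitPlane := fun z hz => by
    left; simpa using hz
  exact (differentiableOn_hypB.continuousOn.mono h2).div (differentiableOn_hypF.continuousOn.mono h1)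
    fun z hz => hypF_ne_zero (h1 z hz)

theorem triangleBranch_of_im_eq_zero {z : ℂ} (hz : z.im = 0) (hz' : z.re < 0) :
    (triangleBranch z).re = 0 ∧ 0 < (triangleBranch z).im := by
  have h1 : 1 - z ∈ slitPlane := by left; simp; linarith
  have h2 : -z ∈ slitPlane := by left; simpa using hz'
  have hc : starRingEnd ℂ z = z := conj_eq_iff_im.2 hz
  have hF : (hypF z).im = 0 := by rw [← conj_eq_iff_im, ← hypF_conj h1, hc]
  have hB : (hypB z).im = 0 := by rw [← conj_eq_iff_im, ← hypB_conj h2, hc]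
  have h3 := hypF_re_pos h1
  have h4 := hypB_re_pos h2
  have hn := normSq_pos.2 (hypF_ne_zero h1)
  unfold triangleBranch
  rw [I_mul_re, I_mul_im, div_re, div_im, hF, hB]
  simp only [mul_zero, zero_mul, zero_div, add_zero, sub_zero, neg_zero, true_and]
  positivity

/-- The point is a limit of values of `i_e` along a vertical approach to the slit; the sign of d
selects the side. -/
theorem add_triangleBranch_mem_closure {z c : ℂ} {d : ℝ} (hd : d ≠ 0) (hz : z.im = 0)
    (hz' : z.re < 0) (hc : c.im = 0)
    (h : ∀ ε : ℝ, 0 < ε →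
      schwarzTriangle (z + ((d * ε : ℝ) : ℂ) * I) = c + triangleBranch (z + ((d * ε : ℝ) : ℂ) * I)) :
    c + triangleBranch z ∈ upperHalfPlane ∩ closure fundamentalQuadrilateral := by
  constructor
  · change 0 < (c + triangleBranch z).im
    rw [add_im, hc, zero_add]
    exact (triangleBranch_of_im_eq_zero hz hz').2
  · have ht : Tendsto (fun ε : ℝ => z + ((d * ε : ℝ) : ℂ) * I) (𝓝[>] 0) (𝓝 z) := by
      have : ContinuousAt (fun ε : ℝ => z + ((d * ε : ℝ) : ℂ) * I) 0 := by fun_prop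
      have h2 := this.tendsto
      simp only [mul_zero, ofReal_zero, zero_mul, add_zero] at h2
      exact h2.mono_left nhdsWithin_le_nhds
    have hcont : ContinuousAt triangleBranch z := continuousOn_triangleBranch.continuousAt
      ((isOpen_lt continuous_re continuous_const).mem_nhds hz')
    refine mem_closure_of_tendsto ((hcont.tendsto.comp ht).const_add c) ?_
    filter_upwards [self_mem_nhdsWithin] with ε hε
    simp only [Function.comp]
    rw [← h ε hε]
    apply schwarzTriangle_mem_of_im_ne_zero
    simp only [add_im, hz, mul_im, ofReal_re, I_im, ofReal_im, I_re, mul_one, mul_zero, add_zero,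
      zero_add]
    exact mul_ne_zero hd (show (0 : ℝ) < ε from hε).ne'

theorem mapsTo_one_add_triangleBranch :
    MapsTo (fun z => 1 + triangleBranch z) ({z : ℂ | z.re < 0} ∩ {z | 0 ≤ z.im})
      (upperHalfPlane ∩ closure fundamentalQuadrilateral) := by
  rintro z ⟨hz, him⟩
  rcases eq_or_lt_of_le him.out with h | h
  · refine add_triangleBranch_mem_closure (d := 1) one_ne_zero h.symm hz one_im fun ε hε => ?_
    exact schwarzTriangle_of_im_pos (by simpa [← h] using hε)
  · simp only [triangleBranch, ← schwarzTriangle_of_im_pos h]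
    have := schwarzTriangle_mem_of_im_ne_zero h.ne'
    exact ⟨this.1, subset_closure this⟩

theorem mapsTo_neg_one_add_triangleBranch :
    MapsTo (fun z => -1 + triangleBranch z) ({z : ℂ | z.re < 0} ∩ {z | z.im ≤ 0})
      (upperHalfPlane ∩ closure fundamentalQuadrilateral) := by
  rintro z ⟨hz, him⟩
  rcases eq_or_lt_of_le him.out with h | h
  · refine add_triangleBranch_mem_closure (d := -1) (by norm_num) h hz (by simp) fun ε hε => ?_
    exact schwarzTriangle_of_im_neg (by simpa [h] using hε)
  · simp only [triangleBranch, ← schwarzTriangle_of_im_neg h]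
    have := schwarzTriangle_mem_of_im_ne_zero h.ne
    exact ⟨this.1, subset_closure this⟩

/-- If `f` has matching values on the vertical sides of the quadrilateral, then
`f ∘ schwarzTriangle` extends continuously across the negative real axis. -/
theorem continuousAt_ite_comp_schwarzTriangle {f : ℂ → ℂ}
    (hf : ContinuousOn f (upperHalfPlane ∩ closure fundamentalQuadrilateral))
    (ha : ∀ z : ℂ, z.re = -1 → 0 < z.im → f z = f (z + 2)) {x : ℂ} (hx : x.im = 0)
    (hx' : x.re < 0) :
    ContinuousAt (fun z => if z.im = 0 then f (1 + triangleBranch z) else f (schwarzTriangle z))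
      x := by
  set g : ℂ → ℂ := fun z => if z.im = 0 then f (1 + triangleBranch z) else f (schwarzTriangle z)
    with hg
  have e1 : EqOn g (fun z => f (1 + triangleBranch z)) ({z : ℂ | z.re < 0} ∩ {z | 0 ≤ z.im}) := by
    rintro z ⟨hz, him⟩
    simp only [hg]
    split_ifs with h
    · rfl
    · rw [schwarzTriangle_of_im_pos (lt_of_le_of_ne him.out (Ne.symm h)), triangleBranch]
  have e2 : EqOn g (fun z => f (-1 + triangleBranch z)) ({z : ℂ | z.re < 0} ∩ {z | z.im ≤ 0}) := by
    rintro z ⟨hz, him⟩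
    simp only [hg]
    split_ifs with h
    · obtain ⟨h1, h2⟩ := triangleBranch_of_im_eq_zero h hz
      -- On the slit `triangleBranch` is purely imaginary, so the two candidate values are taken at
      -- -1 + iy and 1 + iy, which (a) identifies.
      rw [ha (-1 + triangleBranch z) (by simp [h1]) (by simpa using h2)]
      congr 1
      ring
    · rw [schwarzTriangle_of_im_neg (lt_of_le_of_ne him.out h), triangleBranch]
  have c1 : ContinuousWithinAt g ({z : ℂ | z.re < 0} ∩ {z | 0 ≤ z.im}) x := by
    have := (hf.comp (continuousOn_const.add (continuousOn_triangleBranch.mono inter_subset_left))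
      mapsTo_one_add_triangleBranch) x ⟨hx', hx.ge⟩
    exact this.congr e1 (e1 ⟨hx', hx.ge⟩)
  have c2 : ContinuousWithinAt g ({z : ℂ | z.re < 0} ∩ {z | z.im ≤ 0}) x := by
    have := (hf.comp (continuousOn_const.add (continuousOn_triangleBranch.mono inter_subset_left))
      mapsTo_neg_one_add_triangleBranch) x ⟨hx', hx.le⟩
    exact this.congr e2 (e2 ⟨hx', hx.le⟩)
  refine (c1.union c2).continuousAt ?_
  filter_upwards [(isOpen_lt continuous_re continuous_const).mem_nhds hx'] with z hz
  rcases le_total 0 z.im with h | h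
  · exact Or.inl ⟨hz, h⟩
  · exact Or.inr ⟨hz, h⟩

theorem isOpen_slitDomain : IsOpen slitDomain := by
  have e : slitDomain = {z : ℂ | z ∈ slitPlane} ∩ {z | 1 - z ∈ slitPlane} := by
    ext z
    constructor
    · exact mem_slitPlane_of_mem_slitDomain
    · rintro ⟨h1, h2⟩
      by_cases him : z.im = 0
      · left
        refine ⟨z.re, ⟨?_, ?_⟩, Complex.ext (by simp) (by simp [him])⟩
        · simpa [mem_slitPlane_iff, him] using h1
        · simpa [mem_slitPlane_iff, him] using h2
      · exact Or.inr him
  rw [e]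
  exact isOpen_slitPlane.inter (isOpen_slitPlane.preimage (by fun_prop))

theorem differentiableAt_schwarzTriangle {z : ℂ} (hz : z ∈ slitDomain) :
    DifferentiableAt ℂ schwarzTriangle z := by
  obtain ⟨h1, h2⟩ := mem_slitPlane_of_mem_slitDomain hz
  have hd : ∀ w : ℂ, 1 - w ∈ slitPlane → DifferentiableAt ℂ hypF w := fun w hw =>
    differentiableOn_hypF.differentiableAt
      ((isOpen_slitPlane.preimage (by fun_prop : Continuous fun z : ℂ => 1 - z)).mem_nhds hw)
  unfold schwarzTriangle
  refine DifferentiableAt.const_mul (DifferentiableAt.div ?_ (hd z h2) (hypF_ne_zero h2)) I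
  exact DifferentiableAt.comp (f := fun z : ℂ => 1 - z) z (hd (1 - z) (by simpa using h1))
    (by fun_prop)

theorem differentiableAt_comp_schwarzTriangle {f : ℂ → ℂ}
    (hf : DifferentiableOn ℂ f fundamentalQuadrilateral) {z : ℂ} (hz : z ∈ slitDomain) :
    DifferentiableAt ℂ (fun z => f (schwarzTriangle z)) z :=
  DifferentiableAt.comp z (hf.differentiableAt (isOpen_fundamentalQuadrilateral.mem_nhds
    (schwarzTriangle_mem_fundamentalQuadrilateral hz))) (differentiableAt_schwarzTriangle hz)

/-- The extension of `f ∘ schwarzTriangle` across the two slits `(-∞, 0)` and `(1, +∞)`. -/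
noncomputable def slitExtension (f : ℂ → ℂ) (z : ℂ) : ℂ :=
  if z.im = 0 ∧ z.re < 0 then f (1 + triangleBranch z)
  else if z.im = 0 ∧ 1 < z.re then f (-1 / (1 + triangleBranch (1 - z)))
  else f (schwarzTriangle z)

theorem slitExtension_of_mem {f : ℂ → ℂ} {z : ℂ} (hz : z ∈ slitDomain) :
    slitExtension f z = f (schwarzTriangle z) := by
  unfold slitExtension
  rcases hz with ⟨x, hx, rfl⟩ | hz
  · rw [if_neg (fun h => lt_asymm hx.1 (by simpa using h.2)),
      if_neg (fun h => lt_asymm hx.2 (by simpa using h.2))]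
  · rw [if_neg fun h => hz h.1, if_neg fun h => hz h.1]

theorem slitExtension_of_im_ne_zero {f : ℂ → ℂ} {z : ℂ} (hz : z.im ≠ 0) :
    slitExtension f z = f (schwarzTriangle z) :=
  slitExtension_of_mem (Or.inr hz)

theorem continuousOn_slitExtension {f : ℂ → ℂ}
    (hf_hol : DifferentiableOn ℂ f fundamentalQuadrilateral)
    (hf : ContinuousOn f (upperHalfPlane ∩ closure fundamentalQuadrilateral))
    (ha : ∀ z : ℂ, z.re = -1 → 0 < z.im → f z = f (z + 2))
    (hb : ∀ z : ℂ, z.re = -1 → 0 < z.im → f (-1 / z) = f (-1 / (z + 2))) :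
    ContinuousOn (slitExtension f) {0, 1}ᶜ := by
  intro x hx
  apply ContinuousAt.continuousWithinAt
  by_cases hxs : x ∈ slitDomain
  · refine (differentiableAt_comp_schwarzTriangle hf_hol hxs).continuousAt.congr ?_
    filter_upwards [isOpen_slitDomain.mem_nhds hxs] with z hz
    exact (slitExtension_of_mem hz).symm
  · have him : x.im = 0 := by
      by_contra h
      exact hxs (Or.inr h)
    have hre : x.re < 0 ∨ 1 < x.re := by
      by_contra! h
      obtain ⟨h0, h1⟩ := h
      have hxe : (x.re : ℂ) = x := Complex.ext (by simp) (by simp [him])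
      apply hxs
      refine Or.inl ⟨x.re, ⟨lt_of_le_of_ne h0 ?_, lt_of_le_of_ne h1 ?_⟩, hxe⟩
      · intro h
        rw [← h] at hxe
        exact hx (Or.inl (by rw [← hxe]; simp))
      · intro h
        rw [h] at hxe
        exact hx (Or.inr (by rw [← hxe]; simp))
    rcases hre with hre | hre
    · refine (continuousAt_ite_comp_schwarzTriangle hf ha him hre).congr ?_
      filter_upwards [(isOpen_lt continuous_re continuous_const).mem_nhds hre] with z hz
      have hz0 : z.re < 0 := hz
      unfold slitExtension
      by_cases h : z.im = 0
      · simp [h, hz0]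
      · simp [h]
    -- The slit (1, ∞) is the slit (-∞, 0) after z ↦ 1 - z, with f replaced by w ↦ f(-1/w);
    -- condition (a) for that function is condition (b) for f.
    · have hf' : ContinuousOn (fun w => f (-1 / w))
          (upperHalfPlane ∩ closure fundamentalQuadrilateral) := by
        refine hf.comp (continuousOn_const.div continuousOn_id ?_) mapsTo_neg_one_div_closure
        rintro w ⟨hw, -⟩ h0
        have hw' : 0 < w.im := hw
        simp [h0] at hw'
      have hc := continuousAt_ite_comp_schwarzTriangle hf' hb (x := 1 - x) (by simpa using him)
        (by simpa using hre)
      refine (ContinuousAt.comp (f := fun z : ℂ => 1 - z) hc (by fun_prop)).congr ?_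
      filter_upwards [(isOpen_lt continuous_const continuous_re).mem_nhds hre] with z hz
      have hz0 : 1 < z.re := hz
      have e : -1 / schwarzTriangle (1 - z) = schwarzTriangle z := by
        rw [← schwarzTriangle_one_sub, sub_sub_cancel]
      unfold slitExtension
      by_cases h : z.im = 0
      · simp [h, hz0, not_lt.2 (zero_le_one.trans hz0.le)]
      · simp [h, e]

/-! ### Behaviour of the extension at 0, 1 and infinity -/

/-- The growth estimates are available only at nonreal points; continuity carries a non-strict bound
ε/2 to the real ones, and halving restores strictness. -/
theorem tendsto_nhdsNE_of_tendsto_im_ne_zero {H : ℂ → ℂ} {V : Set ℂ} {c : ℂ} (hV : IsOpen V)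
    (hH : ContinuousOn H V) (hVc : V ∈ 𝓝[≠] c)
    (h : Tendsto H (𝓝[{z : ℂ | z.im ≠ 0}] c) (𝓝 0)) : Tendsto H (𝓝[≠] c) (𝓝 0) := by
  rw [Metric.tendsto_nhds]
  intro ε hε
  have h1 := (Metric.tendsto_nhds.1 h) (ε / 2) (half_pos hε)
  rw [eventually_nhdsWithin_iff, Metric.eventually_nhds_iff_ball] at h1
  obtain ⟨δ, hδ, hball⟩ := h1
  have key := le_of_forall_im_ne_zero (p := fun z => ‖H z‖) (q := fun _ => ε / 2)
    (Metric.isOpen_ball.inter hV : IsOpen (Metric.ball c δ ∩ V))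
    (hH.mono inter_subset_right).norm continuousOn_const (fun z hz him => by
      have := hball z hz.1 him
      rw [dist_zero_right] at this
      exact this.le)
  filter_upwards [hVc, nhdsWithin_le_nhds (Metric.ball_mem_nhds c hδ)] with z h2 h3
  rw [dist_zero_right]
  exact (key z ⟨h3, h2⟩).trans_lt (half_lt_self hε)

theorem tendsto_mul_slitExtension_zero {f : ℂ → ℂ} {c : ℂ} {k l : ℂ → ℂ} {n : ℕ}
    (h : (fun z => f (schwarzTriangle z)) =o[𝓝[{z : ℂ | z.im ≠ 0}] c] fun z => (k z)⁻¹ ^ (n + 1))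
    (hl : ContinuousAt l c) (hk : ∀ z : ℂ, z.im ≠ 0 → k z ≠ 0) :
    Tendsto (fun z => k z ^ (n + 1) * l z * slitExtension f z) (𝓝[{z : ℂ | z.im ≠ 0}] c)
      (𝓝 0) := by
  have h1 : (fun z => l z) =O[𝓝[{z : ℂ | z.im ≠ 0}] c] fun _ => (1 : ℂ) :=
    (hl.tendsto.mono_left nhdsWithin_le_nhds).isBigO_one ℂ
  have h2 := ((Asymptotics.isBigO_refl (fun z => k z ^ (n + 1)) _).mul h1).mul_isLittleO h
  rw [← Asymptotics.isLittleO_one_iff ℂ]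
  refine h2.congr' ?_ ?_
  · filter_upwards [self_mem_nhdsWithin] with z hz
    rw [slitExtension_of_im_ne_zero hz]
  · filter_upwards [self_mem_nhdsWithin] with z hz
    rw [mul_one, ← mul_pow, mul_inv_cancel₀ (hk z hz), one_pow]

theorem exists_forall_norm_le_slitExtension {f : ℂ → ℂ} {nInf n0 n1 : ℕ}
    (hc : ContinuousOn (slitExtension f) {0, 1}ᶜ)
    (h : (fun z => f (schwarzTriangle z)) =o[Bornology.cobounded ℂ ⊓ 𝓟 {z : ℂ | z.im ≠ 0}]
      fun z => z ^ (n1 + 1)) {ε : ℝ} (hε : 0 < ε) :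
    ∃ R : ℝ, ∀ z : ℂ, R < ‖z‖ →
      ‖z ^ nInf * (1 - z) ^ n0 * slitExtension f z‖ ≤ ε * ‖z‖ ^ (nInf + n0 + n1 + 1) := by
  -- The division by 2 ^ n0 offsets |1 - z| ≤ 2|z| for |z| > 1.
  have hε' : 0 < ε / 2 ^ n0 := by positivity
  have h1 := h.def hε'
  rw [eventually_inf_principal, ← comap_norm_atTop, eventually_comap, eventually_atTop] at h1
  obtain ⟨R, hR⟩ := h1
  refine ⟨max R 1, ?_⟩
  have hne : ∀ z : ℂ, max R 1 < ‖z‖ → z ∈ ({0, 1}ᶜ : Set ℂ) := by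
    intro z hz h0
    have h2 : 1 < ‖z‖ := (le_max_right _ _).trans_lt hz
    rcases h0 with rfl | rfl
    · simp at h2; linarith
    · simp at h2
  apply le_of_forall_im_ne_zero (U := {z : ℂ | max R 1 < ‖z‖})
    (isOpen_lt continuous_const continuous_norm)
  · exact (ContinuousOn.mul (by fun_prop) (hc.mono hne)).norm
  · fun_prop
  · intro z hz him
    have h2 : 1 < ‖z‖ := (le_max_right _ _).trans_lt hz
    have h3 := hR ‖z‖ ((le_max_left _ _).trans hz.out.le) z rfl him
    have h4 : ‖1 - z‖ ≤ 2 * ‖z‖ := by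
      have := norm_sub_le 1 z
      rw [norm_one] at this
      linarith
    rw [slitExtension_of_im_ne_zero him, norm_mul, norm_mul, norm_pow, norm_pow]
    rw [norm_pow] at h3
    calc ‖z‖ ^ nInf * ‖1 - z‖ ^ n0 * ‖f (schwarzTriangle z)‖
        ≤ ‖z‖ ^ nInf * (2 * ‖z‖) ^ n0 * (ε / 2 ^ n0 * ‖z‖ ^ (n1 + 1)) := by gcongr
      _ = ε * ‖z‖ ^ (nInf + n0 + n1 + 1) := by
        rw [mul_pow]
        field_simp
        ring

end SchwarzTriangle

open SchwarzTriangle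

/-! ### The theorem -/

theorem lemma4p1 (f : ℂ → ℂ)
    (hf_hol : DifferentiableOn ℂ f SchwarzTriangle.fundamentalQuadrilateral)
    (hf_cont : ContinuousOn f
      (SchwarzTriangle.upperHalfPlane ∩ closure SchwarzTriangle.fundamentalQuadrilateral))
    (h_a : ∀ z : ℂ, z.re = -1 → 0 < z.im → f z = f (z + 2))
    (h_b : ∀ z : ℂ, z.re = -1 → 0 < z.im → f (-1 / z) = f (-1 / (z + 2)))
    (nInf n0 n1 : ℕ)
    (h1 : Asymptotics.IsLittleO
      (Bornology.cobounded ℂ ⊓ Filter.principal SchwarzTriangle.fundamentalQuadrilateral)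
      f (fun z : ℂ => Real.exp (Real.pi * ((nInf : ℝ) + 1) * ‖z‖)))
    (h2 : Asymptotics.IsLittleO
      (nhdsWithin (0 : ℂ) SchwarzTriangle.fundamentalQuadrilateral)
      f (fun z : ℂ => Real.exp (Real.pi * ((n0 : ℝ) + 1) * ‖z‖⁻¹)))
    (h3 : ∀ σ : ℂ, σ = 1 ∨ σ = -1 → Asymptotics.IsLittleO
      (nhdsWithin σ SchwarzTriangle.fundamentalQuadrilateral)
      f (fun z : ℂ => Real.exp (Real.pi * ((n1 : ℝ) + 1) * ‖z - σ‖⁻¹))) :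
    ∃ P : Polynomial ℂ, P.natDegree ≤ nInf + n0 + n1 ∧
      ∀ z ∈ SchwarzTriangle.slitDomain,
        f (SchwarzTriangle.schwarzTriangle z) = P.eval z / (z ^ nInf * (1 - z) ^ n0) := by
  have hopen : IsOpen ({0, 1}ᶜ : Set ℂ) := (Set.toFinite _).isClosed.isOpen_compl
  have hcont := continuousOn_slitExtension hf_hol hf_cont h_a h_b
  have hdiff : DifferentiableOn ℂ (slitExtension f) {0, 1}ᶜ := by
    refine differentiableOn_of_continuousOn_of_im_ne_zero hopen hcont fun z _ him => ?_
    refine (differentiableAt_comp_schwarzTriangle hf_hol (Or.inr him)).congr_of_eventuallyEq ?_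
    filter_upwards [isOpen_slitDomain.mem_nhds (Or.inr him)] with w hw
    exact slitExtension_of_mem hw
  have hpoly : Differentiable ℂ fun z : ℂ => z ^ nInf * (1 - z) ^ n0 := by fun_prop
  have hne0 : ({0, 1}ᶜ : Set ℂ) ∈ 𝓝[≠] 0 := by
    filter_upwards [self_mem_nhdsWithin,
      nhdsWithin_le_nhds (isOpen_compl_singleton.mem_nhds (zero_ne_one' ℂ))] with z h h'
    rintro (h0 | h0)
    · exact h h0
    · exact h' h0
  have hne1 : ({0, 1}ᶜ : Set ℂ) ∈ 𝓝[≠] 1 := by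
    filter_upwards [self_mem_nhdsWithin,
      nhdsWithin_le_nhds (isOpen_compl_singleton.mem_nhds (one_ne_zero' ℂ))] with z h h'
    rintro (h0 | h0)
    · exact h' h0
    · exact h h0
  have hlim0 : Tendsto (fun z => z * (z ^ nInf * (1 - z) ^ n0 * slitExtension f z))
      (𝓝[≠] 0) (𝓝 0) := by
    refine tendsto_nhdsNE_of_tendsto_im_ne_zero hopen
      (continuousOn_id.mul (hpoly.continuous.continuousOn.mul hcont)) hne0 ?_
    refine (tendsto_mul_slitExtension_zero (k := id) (l := fun z => (1 - z) ^ n0)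
      (isLittleO_comp_schwarzTriangle_zero h1) (by fun_prop) ?_).congr fun z => ?_
    · rintro z hz rfl
      exact hz rfl
    · simp only [id]
      ring
  have hlim1 : Tendsto (fun z => (z - 1) * (z ^ nInf * (1 - z) ^ n0 * slitExtension f z))
      (𝓝[≠] 1) (𝓝 0) := by
    refine tendsto_nhdsNE_of_tendsto_im_ne_zero hopen
      (ContinuousOn.mul (by fun_prop) (hpoly.continuous.continuousOn.mul hcont)) hne1 ?_
    -- The minus sign in `l` turns one of the n0 + 1 factors 1 - z into the factor z - 1 of the
    -- removability criterion.
    refine (tendsto_mul_slitExtension_zero (k := fun z => 1 - z) (l := fun z => -z ^ nInf)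
      (isLittleO_comp_schwarzTriangle_one h2) (by fun_prop) ?_).congr fun z => ?_
    · intro z hz h
      exact slitPlane_ne_zero (one_sub_mem_slitPlane_of_im_ne_zero hz) h
    · ring
  obtain ⟨P, hP, hPe⟩ := exists_polynomial_of_differentiableOn_compl
    (hpoly.differentiableOn.mul hdiff) hlim0 hlim1 (nInf + n0 + n1)
    (fun ε hε => exists_forall_norm_le_slitExtension hcont
      (isLittleO_comp_schwarzTriangle_infty h3) hε)
  refine ⟨P, hP, fun z hz => ?_⟩
  obtain ⟨hs, hs'⟩ := mem_slitPlane_of_mem_slitDomain hz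
  have hz0 := slitPlane_ne_zero hs
  have hz1 := slitPlane_ne_zero hs'
  rw [← hPe z hz0 (fun h => hz1 (by rw [h, sub_self])), Pi.mul_apply, slitExtension_of_mem hz,
    mul_div_cancel_left₀ _ (mul_ne_zero (pow_ne_zero _ hz0) (pow_ne_zero _ hz1))]
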